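/- Let $(T_t)_{t\ge 0}$ be a quantum dynamical semigroup on $M_N(\mathbb C)$, that is, a continuous one-parameter semigroup ($T_0=\mathrm{id}$, $T_{t+s}=T_tT_s$) of completely positive, trace-preserving linear maps, with generator $\mathcal L(x)=\lim_{t\downarrow0}\frac1t(T_t(x)-x)$. **The Gell-Mann form.** For $1\le i<j\le N$ put $\lambda_{ij}=\frac1{\sqrt2}(E_{ij}+E_{ji})$ and $\lambda_{ji}=\frac{-\imath}{\sqrt2}(E_{ij}-E_{ji})$, and for $1\le n\le N-1$ put $\lambda_{nn}=\frac1{\sqrt{n(n+1)}}\big(\sum_{m=1}^nE_{mm}-nE_{n+1,n+1}\big)$. Suppose that $$\mathcal L(\rho)=-\imath[H,\rho]+\tfrac12\sum c_{ijk\ell}\big([\lambda_{ij},\rho\lambda_{k\ell}]+[\lambda_{ij}\rho,\lambda_{k\ell}]\big),$$ where $H=\sum_n h_nE_{nn}$ with $h_n\in\mathbb R$, and where $C=(c_{ijk\ell})$ is pair block diagonal with diagonal part diagonal: $C=\begin{pmatrix}C^{\mathcal O}&0\\0&C^{\mathcal D_0}\end{pmatrix}$ with respect to the off-diagonal $\lambda_{ij}$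 $(i\ne j)$ and the diagonal $\lambda_{nn}$; $C^{\mathcal D_0}$ is diagonal with entries $c_{nn}$; and the only nonzero entries of $C^{\mathcal O}$ lie in the $2\times2$ blocks $$\begin{pmatrix}c_{ij}&a_{ij}+\imath b_{ij}\\a_{ij}-\imath b_{ij}&c_{ji}\end{pmatrix}\qquad(i<j)$$ with rows and columns $\lambda_{ij},\lambda_{ji}$. ($C$ is then positive semidefinite.) **The digraph.** Let $G_{\mathcal L}$ be the weighted digraph on $\{1,\dots,N\}$ in which, for $i\neq j$, the edge from $j$ to $i$ has weight $\gamma_{ij}=\frac12(c_{ij}+c_{ji}-2b_{ij})$ if $i<j$ and $\gamma_{ij}=\frac12(c_{ij}+c_{ji}+2b_{ji})$ if $i>j$ (no edge if the weight is $0$). Let $G^1,\dots,G^m$ be its terminal strongly connected components, i.e. those strongly connected components from which no other one can be reached. For a component $G^n$ let $\widetilde\rho^{\,n}_i$ be the sum, over all directed spanning trees of $G^n$ rooted at $i$ (all edges directed towards $i$), of the product of the edge weights, with $\widetilde\rho^{\,n}_i=0$ if $i\notin G^n$. Put $\rho^n=\widetilde\rho^{\,n}/\sum_j\widetilde\rho^{\,n}_j$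 and $d^{G^n}=\sum_i\rho^n_iE_{ii}$. A vertex is a *sink* if no edge originates from it. For $k<\ell$, the pair $k\ell$ is a *singular 2-sink* if there are edges from $k$ to $\ell$ and from $\ell$ to $k$, no other edges originate from $k$ or $\ell$, and $c_{k\ell}c_{\ell k}-a_{k\ell}^2=0$. **The blocks.** For $k<\ell$ let $\mathcal L_{k\ell}$ be the $2\times2$ submatrix, with rows and columns $\lambda_{k\ell},\lambda_{\ell k}$, of the matrix of $\mathcal L$ in the Gell-Mann basis; $\ker\mathcal L_{k\ell}$ is regarded as a subspace of $\operatorname{Span}(\lambda_{k\ell},\lambda_{\ell k})$. **Theorem.** (a) One has the direct sum $$\ker\mathcal L=\bigoplus_{k<\ell}\ker\mathcal L_{k\ell}\ \oplus\ \operatorname{Span}\big(d^{G^n}\big)_{n=1}^m .$$ Moreover, for $k<\ell$, $\mathcal L_{k\ell}$ is singular if and only if $h_k=h_\ell$, $c_{nn}=0$ for all $n\ge1$ with $k-1\le n\le\ell-1$, and one of the following holds: * $k$ and $\ell$ are both sinks of $G_{\mathcal L}$, in which case $\ker\mathcal L_{k\ell}=\operatorname{Span}(\lambda_{k\ell},\lambda_{\ell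 k})$; * $k\ell$ is a singular 2-sink of $G_{\mathcal L}$, in which case $\ker\mathcal L_{k\ell}=\mathbb C\{(c_{k\ell}+a_{k\ell})\lambda_{k\ell}+(c_{\ell k}+a_{k\ell})\lambda_{\ell k}\}$ unless $c_{k\ell}=c_{\ell k}=-a_{k\ell}$, and $\ker\mathcal L_{k\ell}=\mathbb C\{\lambda_{k\ell}-\lambda_{\ell k}\}$ if $c_{k\ell}=c_{\ell k}=-a_{k\ell}$. (b) If moreover $C$ is diagonal, let $H_{\mathcal L}$ be the undirected graph obtained from $G_{\mathcal L}$ by forgetting directions, let $H^1,\dots,H^m$ be its connected components, and put $d^{H^n}=\sum_{i\in H^n}E_{ii}$. Then $$\ker\mathcal L=\bigoplus_{k<\ell}\ker\mathcal L_{k\ell}\ \oplus\ \operatorname{Span}\big(d^{H^n}\big)_{n=1}^m ,$$ and for $k<\ell$, $\mathcal L_{k\ell}$ is singular if and only if $h_k=h_\ell$, $c_{nn}=0$ for all $n\ge1$ with $k-1\le n\le\ell-1$, and one of the following holds: * $k$ and $\ell$ are both isolated vertices of $H_{\mathcal L}$, in which case $\ker\mathcal L_{k\ell}=\operatorname{Span}(\lambda_{k\ell},\lambda_{\ell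 k})$; * $k\ell$ is an isolated edge of $H_{\mathcal L}$ with $c_{k\ell}c_{\ell k}=0$, in which case $\ker\mathcal L_{k\ell}=\mathbb C\{\lambda_{k\ell}\}$ if $c_{\ell k}=0$ and $\ker\mathcal L_{k\ell}=\mathbb C\{\lambda_{\ell k}\}$ if $c_{k\ell}=0$. -/

import Mathlib

open scoped Topology Matrix ComplexOrder

namespace QDS

noncomputable section

/-- Complex `N × N` matrices. -/
abbrev Mat (N : ℕ) := Matrix (Fin N) (Fin N) ℂ

/-! ### Quantum dynamical semigroups and their generators -/

/-- The amplification `id ⊗ Φ` acting on `m × m` block matrices with blocks in `M_N(ℂ)`: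
`Φ` is applied to every block. -/
def amplify {N : ℕ} (m : ℕ) (Φ : Mat N →ₗ[ℂ] Mat N)
    (X : Matrix (Fin m × Fin N) (Fin m × Fin N) ℂ) :
    Matrix (Fin m × Fin N) (Fin m × Fin N) ℂ :=
  Matrix.of fun a b => Φ (Matrix.of fun i j => X (a.1, i) (b.1, j)) a.2 b.2

/-- Complete positivity: all amplifications preserve positive semidefiniteness. -/
def IsCompletelyPositive {N : ℕ} (Φ : Mat N →ₗ[ℂ] Mat N) : Prop :=
  ∀ (m : ℕ) (X : Matrix (Fin m × Fin N) (Fin m × Fin N) ℂ),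
    X.PosSemidef → (amplify m Φ X).PosSemidef

/-- `(T t)_{t ≥ 0}` is a quantum dynamical semigroup on `M_N(ℂ)` (Schrödinger picture). Only the
values at `t ≥ 0` matter. In finite dimension weak continuity is continuity. -/
structure IsQDS {N : ℕ} (T : ℝ → (Mat N →ₗ[ℂ] Mat N)) : Prop where
  zero : T 0 = LinearMap.id
  add : ∀ s t : ℝ, 0 ≤ s → 0 ≤ t → T (t + s) = T t ∘ₗ T s
  continuous : ∀ A : Mat N, ContinuousOn (fun t => T t A) (Set.Ici 0)
  trace : ∀ t : ℝ, 0 ≤ t → ∀ A : Mat N, (T t A).trace = A.trace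
  completelyPositive : ∀ t : ℝ, 0 ≤ t → IsCompletelyPositive (T t)

/-- `L` is the generator of some quantum dynamical semigroup:
`L x = lim_{t ↓ 0} (T t x - x) / t`. -/
def IsQDSGenerator {N : ℕ} (L : Mat N →ₗ[ℂ] Mat N) : Prop :=
  ∃ T : ℝ → (Mat N →ₗ[ℂ] Mat N), IsQDS T ∧
    ∀ x : Mat N, Filter.Tendsto (fun t : ℝ => ((t⁻¹ : ℝ) : ℂ) • (T t x - x)) (𝓝[>] 0) (𝓝 (L x))

/-! ### The Gell-Mann basis. Vertices and rows are numbered `0, …, N - 1`. -/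

/-- The off-diagonal Gell-Mann matrices: for `i < j`,
`λ_{ij} = (E_{ij} + E_{ji}) / √2` and `λ_{ji} = -𝕚 (E_{ij} - E_{ji}) / √2`.
Only used for `i ≠ j`. -/
def lamOff {N : ℕ} (i j : Fin N) : Mat N :=
  if i < j then ((1 / Real.sqrt 2 : ℝ) : ℂ) • (Matrix.single i j 1 + Matrix.single j i 1)
  else (-Complex.I * ((1 / Real.sqrt 2 : ℝ) : ℂ)) • (Matrix.single j i 1 - Matrix.single i j 1)

/-- The diagonal Gell-Mann matrices. With the one-based number `n + 1` for `n : Fin (N - 1)` this is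
`λ_{n+1,n+1} = (E_{11} + ⋯ + E_{n+1,n+1} - (n + 1) E_{n+2,n+2}) / √((n + 1) (n + 2))`. -/
def lamDiag {N : ℕ} (n : Fin (N - 1)) : Mat N :=
  ((1 / Real.sqrt (((n : ℝ) + 1) * ((n : ℝ) + 2)) : ℝ) : ℂ) •
    Matrix.diagonal fun m : Fin N =>
      if (m : ℕ) ≤ (n : ℕ) then (1 : ℂ)
      else if (m : ℕ) = (n : ℕ) + 1 then -((n : ℂ) + 1) else 0

/-- Ordered pairs `(i, j)` with `i ≠ j`, labelling the off-diagonal Gell-Mann matrices. -/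
abbrev OffIndex (N : ℕ) := {p : Fin N × Fin N // p.1 ≠ p.2}

/-- Labels of the `N² - 1` traceless Gell-Mann matrices: off-diagonal ones, then diagonal ones. -/
abbrev GMIndex (N : ℕ) := OffIndex N ⊕ Fin (N - 1)

/-- The Gell-Mann basis of the traceless matrices. -/
def lam {N : ℕ} : GMIndex N → Mat N
  | Sum.inl p => lamOff p.1.1 p.1.2
  | Sum.inr n => lamDiag n

/-- The Gell-Mann form with Hamiltonian `H` and coefficient matrix `C`:
`ρ ↦ -𝕚 [H, ρ] + ½ ∑ c_{pq} ([λ_p, ρ λ_q] + [λ_p ρ, λ_q])`. -/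
def gellMannForm {N : ℕ} (H : Mat N) (C : Matrix (GMIndex N) (GMIndex N) ℂ) (ρ : Mat N) : Mat N :=
  -(Complex.I • ⁅H, ρ⁆) +
    (1 / 2 : ℂ) • ∑ p, ∑ q, C p q • (⁅lam p, ρ * lam q⁆ + ⁅lam p * ρ, lam q⁆)

/-- A matrix on the off-diagonal labels is pair block diagonal if its only nonzero entries lie in
the `2 × 2` blocks with rows and columns `(i, j)`, `(j, i)`. -/
def IsPairBlockDiagonal {N : ℕ} (A : Matrix (OffIndex N) (OffIndex N) ℂ) : Prop :=
  ∀ p q : OffIndex N, q ≠ p → q.1 ≠ p.1.swap → A p q = 0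

/-- The diagonal entry `c_{ij}` of `C` at the label `(i, j)`, `i ≠ j` (as a real number). -/
def cOff {N : ℕ} (C : Matrix (GMIndex N) (GMIndex N) ℂ) (i j : Fin N) : ℝ :=
  if hij : i ≠ j then (C (Sum.inl ⟨(i, j), hij⟩) (Sum.inl ⟨(i, j), hij⟩)).re else 0

/-- The entry of `C` in row `(i, j)` and column `(j, i)`; for `i < j` it is `a_{ij} + 𝕚 b_{ij}`. -/
def cPair {N : ℕ} (C : Matrix (GMIndex N) (GMIndex N) ℂ) (i j : Fin N) : ℂ :=
  if hij : i ≠ j then C (Sum.inl ⟨(i, j), hij⟩) (Sum.inl ⟨(j, i), hij.symm⟩) else 0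

/-- `a_{ij}`, for `i < j`. -/
def aOff {N : ℕ} (C : Matrix (GMIndex N) (GMIndex N) ℂ) (i j : Fin N) : ℝ := (cPair C i j).re

/-- `b_{ij}`, for `i < j`. -/
def bOff {N : ℕ} (C : Matrix (GMIndex N) (GMIndex N) ℂ) (i j : Fin N) : ℝ := (cPair C i j).im

/-! ### The `kℓ` blocks of a superoperator -/

/-- The two Gell-Mann matrices `λ_{kℓ}`, `λ_{ℓk}`. -/
def lamPair {N : ℕ} (k l : Fin N) : Fin 2 → Mat N := ![lamOff k l, lamOff l k]

/-- The `kℓ` block `L_{kℓ}` of `L`: the `2 × 2` submatrix of the matrix of `L` in the Gell-Mann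
basis (orthonormal for `⟨A, B⟩ = Tr (A* B)`) with rows and columns `λ_{kℓ}`, `λ_{ℓk}`. -/
def pairBlock {N : ℕ} (L : Mat N →ₗ[ℂ] Mat N) (k l : Fin N) : Matrix (Fin 2) (Fin 2) ℂ :=
  Matrix.of fun r s => ((lamPair k l r)ᴴ * L (lamPair k l s)).trace

/-- `ker L_{kℓ}`, seen inside `M_N(ℂ)` through `(x, y) ↦ x λ_{kℓ} + y λ_{ℓk}`. -/
def kerPairBlock {N : ℕ} (L : Mat N →ₗ[ℂ] Mat N) (k l : Fin N) : Submodule ℂ (Mat N) :=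
  (LinearMap.ker (Matrix.toLin' (pairBlock L k l))).map
    (Fintype.linearCombination ℂ (lamPair k l))

/-! ### Weighted digraphs. The entry `w i j` (`i ≠ j`) is the weight of the edge from `j` to `i`;
there is an edge exactly when the weight is positive. -/

/-- There is an edge from `i` to `j`. -/
def HasEdge {N : ℕ} (w : Fin N → Fin N → ℝ) (i j : Fin N) : Prop := i ≠ j ∧ 0 < w j i

/-- There is a (possibly empty) directed path from `i` to `j`. -/
def Reaches {N : ℕ} (w : Fin N → Fin N → ℝ) : Fin N → Fin N → Prop :=
  Relation.ReflTransGen (HasEdge w)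

open Classical in
/-- The vertex set of the strongly connected component of `i`. -/
def scc {N : ℕ} (w : Fin N → Fin N → ℝ) (i : Fin N) : Finset (Fin N) :=
  Finset.univ.filter fun j => Reaches w i j ∧ Reaches w j i

/-- `S` is the vertex set of a terminal strongly connected component. -/
def IsTSCC {N : ℕ} (w : Fin N → Fin N → ℝ) (S : Finset (Fin N)) : Prop :=
  ∃ i, S = scc w i ∧ ∀ j, Reaches w i j → scc w j = scc w i

/-- `T` is the edge set of a directed spanning subtree, rooted at `r`, of the subdigraph induced on
`S`: forgetting directions gives a tree on `S` (no two edges of `T` joining the same pair of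
vertices), and `r` is the only vertex from which no edge of `T` originates. -/
structure IsRootedSpanningTree {N : ℕ} (w : Fin N → Fin N → ℝ) (S : Finset (Fin N)) (r : Fin N)
    (T : Finset (Fin N × Fin N)) : Prop where
  subgraph : ∀ e ∈ T, e.1 ∈ S ∧ e.2 ∈ S ∧ HasEdge w e.1 e.2
  no_antiparallel : ∀ e ∈ T, e.swap ∉ T
  isTree : (SimpleGraph.fromRel fun u v : {x // x ∈ S} => (u.1, v.1) ∈ T).IsTree
  root_mem : r ∈ S
  root : ∀ v ∈ S, (∀ u, (v, u) ∉ T) ↔ v = r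

open Classical in
/-- Total weight of the directed spanning subtrees rooted at `r` (zero if `r ∉ S`). -/
def treeWeight {N : ℕ} (w : Fin N → Fin N → ℝ) (S : Finset (Fin N)) (r : Fin N) : ℝ :=
  ∑ T : Finset (Fin N × Fin N) with IsRootedSpanningTree w S r T, ∏ e ∈ T, w e.2 e.1

/-- The matrix `d^S = ∑ i, ρ_i E_{ii}`, with `ρ` the vector of tree weights scaled to total `1`. -/
def dTSCC {N : ℕ} (w : Fin N → Fin N → ℝ) (S : Finset (Fin N)) : Mat N :=
  Matrix.diagonal fun i => ((treeWeight w S i / ∑ j, treeWeight w S j : ℝ) : ℂ)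

/-- A sink: no edge originates from `k`. -/
def IsSink {N : ℕ} (w : Fin N → Fin N → ℝ) (k : Fin N) : Prop := ∀ j, ¬ HasEdge w k j

/-- A 2-sink: edges from `k` to `l` and from `l` to `k`, and no other edges originate from them. -/
def IsTwoSink {N : ℕ} (w : Fin N → Fin N → ℝ) (k l : Fin N) : Prop :=
  HasEdge w k l ∧ HasEdge w l k ∧
    ∀ j, j ≠ k → j ≠ l → ¬ HasEdge w k j ∧ ¬ HasEdge w l j

/-! ### The digraph of a generator in Gell-Mann form -/

/-- The weight `γ_{ij}` of the edge from `j` to `i` in the digraph of the generator. It is the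
diagonal coefficient at `E_{ij}` when the generator is rewritten in the standard basis. -/
def gamma {N : ℕ} (C : Matrix (GMIndex N) (GMIndex N) ℂ) (i j : Fin N) : ℝ :=
  if i < j then (cOff C i j + cOff C j i - 2 * bOff C i j) / 2
  else if j < i then (cOff C j i + cOff C i j + 2 * bOff C j i) / 2
  else 0

/-- Singular 2-sinks `kl`, `k < l`. -/
def IsSingularTwoSink {N : ℕ} (C : Matrix (GMIndex N) (GMIndex N) ℂ) (k l : Fin N) : Prop :=
  IsTwoSink (gamma C) k l ∧ cOff C k l * cOff C l k - aOff C k l ^ 2 = 0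

/-- The digraph of the generator with directions forgotten. -/
def undirected {N : ℕ} (C : Matrix (GMIndex N) (GMIndex N) ℂ) : SimpleGraph (Fin N) :=
  SimpleGraph.fromRel (HasEdge (gamma C))

/-- Isolated vertices. -/
def IsIsolatedVertex {N : ℕ} (G : SimpleGraph (Fin N)) (k : Fin N) : Prop := ∀ j, ¬ G.Adj k j

/-- Isolated edges. -/
def IsIsolatedEdge {N : ℕ} (G : SimpleGraph (Fin N)) (k l : Fin N) : Prop :=
  G.Adj k l ∧ ∀ j, j ≠ k → j ≠ l → ¬ G.Adj k j ∧ ¬ G.Adj l j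

open Classical in
/-- The indicator of a connected component `K`, as a diagonal matrix. -/
def dComponent {N : ℕ} (G : SimpleGraph (Fin N)) (K : G.ConnectedComponent) : Mat N :=
  Matrix.diagonal fun i => if G.connectedComponentMk i = K then 1 else 0

/-- `c_{nn} = 0` for all `k - 1 ≤ n ≤ ℓ - 1` (`1 ≤ n`) in one-based numbering. -/
def DiagVanishes {N : ℕ} (C : Matrix (GMIndex N) (GMIndex N) ℂ) (k l : Fin N) : Prop :=
  ∀ n : Fin (N - 1), (k : ℕ) ≤ (n : ℕ) + 1 → (n : ℕ) + 1 ≤ (l : ℕ) →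
    C (Sum.inr n) (Sum.inr n) = 0

/-- `W` is the internal direct sum of the kernels of the blocks `L_{kℓ}`, `k < ℓ`, and of `V`. -/
def IsDirectSumOfBlockKernels {N : ℕ} (L : Mat N →ₗ[ℂ] Mat N) (V W : Submodule ℂ (Mat N)) :
    Prop :=
  let F : Option {p : Fin N × Fin N // p.1 < p.2} → Submodule ℂ (Mat N) := fun o =>
    o.elim V fun p => kerPairBlock L p.1.1 p.1.2
  iSupIndep F ∧ ⨆ o, F o = W

end

end QDS

/-! ### The Markov chain tree theorem for functional graphs -/

namespace FunctionalGraph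

/-! In the standard basis the generator nearly decouples. Writing each Gell-Mann pair in terms of
$E_{ij}, E_{ji}$ turns the $2\times2$ block of $C$ into one with diagonal entries
$\gamma_{ij},\gamma_{ji}$ and off-diagonal entries $\kappa_{ij},\kappa_{ji}$. The entry of $\mathcal
L\rho$ at $(m,n)$, $m\ne n$, then involves only $\rho_{mn}$ and $\rho_{nm}$, while diagonal entries
evolve by the classical rate equation of the digraph (`gellMannForm_apply`). So $\mathcal L$
preserves the diagonal matrices and each span of $\lambda_{k\ell},\lambda_{\ell k}$, and its kernel
is the direct sum of the kernels of the pieces (`HasEntryFormula.isDirectSum`).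

The diagonal piece is the space of stationary vectors. Norms of a stationary vector are again
stationary, so its zeros propagate backwards along edges; a stationary vector is therefore
determined by its values at one vertex of each terminal component (`span_eq_stationary`). The Markov
chain tree theorem `arbWeight_mul_sum` supplies a stationary vector on each such component. For
symmetric weights the indicators of connected components serve instead.

For the off-diagonal blocks, the determinant is a sum of three terms: $(h_k-h_\ell)^2$, the excess
of the squared decay rate over $((c_{k\ell}+c_{\ell k})/2)^2$, and $c_{k\ell}c_{\ell
k}-a_{k\ell}^2$. All are nonnegative, so the block is singular exactly when all vanish
(`HasEntryFormula.det_eq_zero_iff`), which is then read off from the digraph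
(`HasEntryFormula.singular_iff`).

Every sign used here comes from complete positivity: the Choi form of $\mathcal L$ is nonnegative at
traceless matrices, and testing it on suitable matrices gives positivity of the blocks of $C$
(`IsQDSGenerator.isPairPositive`). -/

/-- Every orbit of `f` meets `r`. -/
def Attracts {V : Type*} (r : V) (f : V → V) : Prop := ∀ v, ∃ n : ℕ, f^[n] v = r

/-- An orbit is unaffected by the change until it first meets `r`, which is all that has to be
reached. -/
theorem Attracts.update {V : Type*} [DecidableEq V] {r : V} {f : V → V} (hf : Attracts r f)
    (k : V) : Attracts r (Function.update f r k) := by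
  intro v
  obtain ⟨n, hn⟩ := hf v
  induction n generalizing v with
  | zero => exact ⟨0, hn⟩
  | succ n ih =>
    by_cases hv : v = r
    · exact ⟨0, hv⟩
    · obtain ⟨m, hm⟩ := ih (f v) (by simpa using hn)
      exact ⟨m + 1, by simpa [Function.update_of_ne hv] using hm⟩

/-- The element preceding `i` on its cycle. -/
noncomputable def cyclePred {V : Type*} (g : V → V) (i : V) : V :=
  g^[Function.minimalPeriod g i - 1] i

theorem Attracts.minimalPeriod_pos {V : Type*} {i : V} {g : V → V} (hg : Attracts i g) :
    0 < Function.minimalPeriod g i := by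
  obtain ⟨n, hn⟩ := hg (g i)
  exact Function.IsPeriodicPt.minimalPeriod_pos (n := n + 1) (Nat.succ_pos n) hn

theorem Attracts.apply_cyclePred {V : Type*} {i : V} {g : V → V} (hg : Attracts i g) :
    g (cyclePred g i) = i := by
  have h := hg.minimalPeriod_pos
  rw [cyclePred, ← Function.iterate_succ_apply' g, Nat.succ_eq_add_one, Nat.sub_add_cancel h]
  exact Function.iterate_minimalPeriod

theorem Attracts.update_cyclePred {V : Type*} [DecidableEq V] {i : V} {g : V → V}
    (hg : Attracts i g) : Function.update g (cyclePred g i) i = g := by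
  conv_lhs => enter [3]; rw [← hg.apply_cyclePred]
  exact Function.update_eq_self _ _

/-- Since `m + 1` is a multiple of the minimal period, `m` is congruent to the period minus one.
This recovers the cut edge when the bijection of `sum_attracts_eq_in` is inverted. -/
theorem cyclePred_eq {V : Type*} {i j : V} {g : V → V} {m : ℕ} (hm : g^[m] i = j) (hj : g j = i) :
    cyclePred g i = j := by
  have hper : Function.IsPeriodicPt g (m + 1) i := by
    rw [Function.IsPeriodicPt, Function.IsFixedPt, Function.iterate_succ_apply', hm, hj]
  have hpos := hper.minimalPeriod_pos (Nat.succ_pos m)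
  obtain ⟨q, hq⟩ := hper.minimalPeriod_dvd
  rw [← hm, ← Function.iterate_mod_minimalPeriod_eq, cyclePred]
  congr 1
  obtain _ | q := q
  · simp at hq
  · have : m = (Function.minimalPeriod g i - 1) + Function.minimalPeriod g i * q := by
      rw [Nat.mul_succ] at hq
      omega
    conv_rhs => rw [this, Nat.add_mul_mod_self_left]
    rw [Nat.mod_eq_of_lt (by omega)]

theorem Attracts.trans {V : Type*} {i j : V} {g : V → V} (hg : Attracts i g) {n : ℕ}
    (hn : g^[n] i = j) : Attracts j g := by
  intro v
  obtain ⟨m, hm⟩ := hg v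
  exact ⟨n + m, by rw [Function.iterate_add_apply, hm, hn]⟩

/-- The functional graphs of trees directed towards the root `r`, with a loop at `r`. -/
def IsArborescence {V : Type*} (r : V) (f : V → V) : Prop := f r = r ∧ Attracts r f

theorem IsArborescence.update_root {V : Type*} [DecidableEq V] {r : V} {f : V → V}
    (hf : IsArborescence r f) : Function.update f r r = f := by
  conv_lhs => rw [← hf.1]
  simp [hf.1]

open Classical in
/-- Total weight of the arborescences with root `r`; `w i j` is the weight of `j → i`. -/
noncomputable def arbWeight {V R : Type*} [Fintype V] [DecidableEq V] [CommSemiring R]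
    (w : V → V → R) (r : V) : R :=
  ∑ f : V → V with IsArborescence r f, ∏ v ∈ Finset.univ.erase r, w (f v) v

theorem prod_update {V R : Type*} [Fintype V] [DecidableEq V] [CommSemiring R] (w : V → V → R)
    (f : V → V) (j i : V) :
    ∏ v, w (Function.update f j i v) v = w i j * ∏ v ∈ Finset.univ.erase j, w (f v) v := by
  rw [← Finset.mul_prod_erase _ _ (Finset.mem_univ j), Function.update_self]
  congr 1
  refine Finset.prod_congr rfl fun v hv => ?_
  rw [Function.update_of_ne (Finset.ne_of_mem_erase hv)]

open Classical in
-- A map attracted to `i` is an arborescence rooted at `i` together with an arbitrary value at `i`: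
-- replacing the loop at the root by an edge `i → k` creates one cycle through `i`.
theorem sum_attracts_eq_out {V R : Type*} [Fintype V] [DecidableEq V] [CommSemiring R]
    (w : V → V → R) (i : V) :
    ∑ g : V → V with Attracts i g, ∏ v, w (g v) v = arbWeight w i * ∑ k, w k i := by
  rw [arbWeight, Finset.sum_mul_sum, ← Finset.sum_product']
  refine Finset.sum_nbij' (fun g => (Function.update g i i, g i))
    (fun x => Function.update x.1 i x.2) ?_ ?_ ?_ ?_ ?_
  · intro g hg
    simp only [Finset.mem_filter, Finset.mem_univ, true_and, Finset.mem_product, and_true] at hg ⊢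
    exact ⟨by simp, hg.update i⟩
  · rintro ⟨f, k⟩ hf
    simp only [Finset.mem_filter, Finset.mem_univ, true_and, Finset.mem_product, and_true] at hf ⊢
    exact hf.2.update k
  · intro g _
    simp
  · rintro ⟨f, k⟩ hf
    simp only [Finset.mem_filter, Finset.mem_univ, true_and, Finset.mem_product, and_true] at hf
    simp only [Function.update_idem, Function.update_self, Prod.mk.injEq, and_true]
    exact hf.update_root
  · intro g _
    rw [mul_comm, ← prod_update, Function.update_idem, Function.update_eq_self]

open Classical in
-- The same unicyclic maps, now cut at the cycle edge `j → i` entering `i`: what remains is an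
-- arborescence rooted at `j`.
theorem sum_attracts_eq_in {V R : Type*} [Fintype V] [DecidableEq V] [CommSemiring R]
    (w : V → V → R) (i : V) :
    ∑ g : V → V with Attracts i g, ∏ v, w (g v) v = ∑ j, w i j * arbWeight w j := by
  simp only [arbWeight, Finset.mul_sum]
  rw [Finset.sum_sigma']
  refine Finset.sum_nbij'
    (fun g => (⟨cyclePred g i, Function.update g (cyclePred g i) (cyclePred g i)⟩ :
      (_ : V) × (V → V)))
    (fun x => Function.update x.2 x.1 i) ?_ ?_ ?_ ?_ ?_
  · intro g hg
    simp only [Finset.mem_filter, Finset.mem_univ, true_and, Finset.mem_sigma] at hg ⊢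
    exact ⟨by simp, (hg.trans rfl : Attracts (cyclePred g i) g).update _⟩
  · rintro ⟨j, f⟩ hf
    simp only [Finset.mem_filter, Finset.mem_univ, true_and, Finset.mem_sigma] at hf ⊢
    exact (hf.2.update i).trans (n := 1) (by simp)
  · intro g hg
    simp only [Finset.mem_filter, Finset.mem_univ, true_and] at hg
    simp only [Function.update_idem]
    exact hg.update_cyclePred
  · rintro ⟨j, f⟩ hf
    simp only [Finset.mem_filter, Finset.mem_univ, true_and, Finset.mem_sigma] at hf
    obtain ⟨m, hm⟩ := (hf.2.update i) i
    have hj : cyclePred (Function.update f j i) i = j := cyclePred_eq hm (by simp)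
    simp only [hj, Function.update_idem, Sigma.mk.injEq, heq_eq_eq, true_and]
    exact hf.update_root
  · intro g hg
    simp only [Finset.mem_filter, Finset.mem_univ, true_and] at hg
    rw [← prod_update, Function.update_idem, hg.update_cyclePred]

/-- **Markov chain tree theorem**: arborescence weights form a stationary vector. -/
theorem arbWeight_mul_sum {V R : Type*} [Fintype V] [DecidableEq V] [CommSemiring R]
    (w : V → V → R) (i : V) :
    arbWeight w i * ∑ k, w k i = ∑ j, w i j * arbWeight w j := by
  classical
  rw [← sum_attracts_eq_out, sum_attracts_eq_in]

/-- If every vertex can reach `r` along edges of positive weight, then some arborescence with root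
`r` has positive weight. -/
theorem arbWeight_pos {V : Type*} [Fintype V] [DecidableEq V] {w : V → V → ℝ}
    (hw : ∀ i j, 0 ≤ w i j) {r : V}
    (h : ∀ v, Relation.ReflTransGen (fun a b => 0 < w b a) v r) : 0 < arbWeight w r := by
  classical
  -- `R n v` says that a walk of `n` positive edges leads from `v` to `r`. With `d` the resulting
  -- distance, sending each vertex to a neighbour nearer to `r` gives a breadth-first arborescence.
  let R : ℕ → V → Prop := fun n =>
    Nat.rec (fun v => v = r) (fun _ P v => ∃ u, 0 < w u v ∧ P u) n
  have hR : ∀ v, ∃ n, R n v := fun v => by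
    induction h v using Relation.ReflTransGen.head_induction_on with
    | refl => exact ⟨0, rfl⟩
    | head hab _ ih => exact ih.elim fun n hn => ⟨n + 1, _, hab, hn⟩
  obtain ⟨d, hd, hdmin⟩ : ∃ d : V → ℕ, (∀ v, R (d v) v) ∧ ∀ v n, R n v → d v ≤ n :=
    ⟨fun v => sInf {n | R n v}, fun v => Nat.sInf_mem (hR v), fun v _ hn => Nat.sInf_le hn⟩
  have hstep : ∀ v, ∃ u, v ≠ r → 0 < w u v ∧ d u < d v := by
    intro v
    have hs := hd v
    rcases hn : d v with _ | n
    · rw [hn] at hs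
      exact ⟨v, fun h => absurd hs h⟩
    · rw [hn] at hs
      obtain ⟨u, hu, hu'⟩ := hs
      exact ⟨u, fun _ => ⟨hu, Nat.lt_succ_of_le (hdmin u n hu')⟩⟩
  choose f hf using hstep
  have hatt : Attracts r f := by
    intro v
    induction hd : d v using Nat.strong_induction_on generalizing v with
    | _ n ih =>
      by_cases hv : v = r
      · exact ⟨0, hv⟩
      · obtain ⟨n, hn⟩ := ih _ (hd ▸ (hf v hv).2) (f v) rfl
        exact ⟨n + 1, hn⟩
  refine Finset.sum_pos' (fun g _ => Finset.prod_nonneg fun v _ => hw _ _)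
    ⟨Function.update f r r, ?_, ?_⟩
  · exact Finset.mem_filter.2 ⟨Finset.mem_univ _, Function.update_self .., hatt.update r⟩
  · refine Finset.prod_pos fun v hv => ?_
    have hv := Finset.ne_of_mem_erase hv
    rw [Function.update_of_ne hv]
    exact (hf v hv).1

end FunctionalGraph

/-! ### Rooted spanning trees as functional graphs -/

namespace FunctionalGraph

/-- The orbit of `v` stays in `{u, v}`, so one of them is the root; the root is fixed, hence both
are. This rules out loops and antiparallel edges away from the root. -/
theorem IsArborescence.eq_root_of_two_cycle {V : Type*} {r u v : V} {f : V → V}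
    (hf : IsArborescence r f) (hv : f v = u) (hu : f u = v) : v = r := by
  have h : ∀ n, f^[n] v = v ∨ f^[n] v = u := fun n => by
    induction n with
    | zero => exact Or.inl rfl
    | succ n ih =>
      rw [Function.iterate_succ_apply']
      rcases ih with h | h <;> simp [h, hv, hu]
  obtain ⟨n, hn⟩ := hf.2 v
  rcases h n with h | h
  · exact h.symm.trans hn
  · rw [← hu, ← h, hn, hf.1]

theorem IsArborescence.eq_root_of_fixed {V : Type*} {r v : V} {f : V → V}
    (hf : IsArborescence r f) (hv : f v = v) : v = r :=
  hf.eq_root_of_two_cycle hv hv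

/-- Every vertex flows to `r`, so the graph is connected, and `v ↦ {v, f v}` matches the non-root
vertices with the edges, so the edge count is that of a tree. -/
theorem IsArborescence.isTree {V : Type*} [Finite V] {r : V} {f : V → V}
    (hf : IsArborescence r f) :
    (SimpleGraph.fromRel fun u v => u ≠ r ∧ f u = v).IsTree := by
  classical
  have := Fintype.ofFinite V
  set G := SimpleGraph.fromRel fun u v => u ≠ r ∧ f u = v
  have hadj : ∀ v, v ≠ r → G.Adj v (f v) := fun v hv => by
    rw [SimpleGraph.fromRel_adj]
    exact ⟨fun h => hv (hf.eq_root_of_fixed h.symm), Or.inl ⟨hv, rfl⟩⟩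
  rw [SimpleGraph.isTree_iff_connected_and_card]
  constructor
  · have hreach : ∀ v, G.Reachable v r := by
      intro v
      obtain ⟨n, hn⟩ := hf.2 v
      induction n generalizing v with
      | zero => exact hn ▸ SimpleGraph.Reachable.refl _
      | succ n ih =>
        by_cases hv : v = r
        · exact hv ▸ SimpleGraph.Reachable.refl _
        · exact (hadj v hv).reachable.trans (ih (f v) hn)
    exact SimpleGraph.connected_iff _ |>.2
      ⟨fun u v => (hreach u).trans (hreach v).symm, ⟨r⟩⟩
  · let e : {v // v ≠ r} → G.edgeSet := fun v => ⟨s(v.1, f v.1), hadj v v.2⟩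
    have he : Function.Bijective e := by
      constructor
      · intro u v huv
        have := congrArg Subtype.val huv
        rcases Sym2.eq_iff.1 this with h | h
        · exact Subtype.ext h.1
        · exact absurd (hf.eq_root_of_two_cycle h.1.symm h.2) v.2
      · rintro ⟨x, hx⟩
        induction x using Sym2.ind with
        | _ a b =>
          rw [SimpleGraph.mem_edgeSet, SimpleGraph.fromRel_adj] at hx
          rcases hx.2 with h | h
          · exact ⟨⟨a, h.1⟩, Subtype.ext (by simp [e, h.2])⟩
          · exact ⟨⟨b, h.1⟩, Subtype.ext (by simp [e, h.2, Sym2.eq_swap])⟩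
    rw [← Nat.card_congr (Equiv.ofBijective e he), Nat.card_eq_fintype_card,
      Nat.card_eq_fintype_card, Fintype.card_subtype_compl, Fintype.card_subtype_eq]
    exact Nat.sub_add_cancel (Fintype.card_pos_iff.2 ⟨r⟩)

end FunctionalGraph

namespace QDS

open FunctionalGraph

/-- The edges `v → f v` with `v ≠ r`. -/
def arbEdges {N : ℕ} {S : Finset (Fin N)} (r : S) (f : S → S) : Finset (Fin N × Fin N) :=
  (Finset.univ.erase r).image fun v => (v.1, (f v).1)

theorem mem_arbEdges {N : ℕ} {S : Finset (Fin N)} {r u v : S} {f : S → S} :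
    (u.1, v.1) ∈ arbEdges r f ↔ u ≠ r ∧ f u = v := by
  simp only [arbEdges, Finset.mem_image, Finset.mem_erase, Finset.mem_univ, and_true,
    Prod.mk.injEq, Subtype.coe_inj]
  exact ⟨by rintro ⟨x, hx, rfl, h⟩; exact ⟨hx, h⟩, fun h => ⟨u, h.1, rfl, h.2⟩⟩

theorem exists_of_mem_arbEdges {N : ℕ} {S : Finset (Fin N)} {r : S} {f : S → S}
    {e : Fin N × Fin N} (he : e ∈ arbEdges r f) : ∃ v : S, v ≠ r ∧ e = (v.1, (f v).1) := by
  simp only [arbEdges, Finset.mem_image, Finset.mem_erase, Finset.mem_univ, and_true] at he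
  obtain ⟨v, hv, rfl⟩ := he
  exact ⟨v, hv, rfl⟩

theorem isRootedSpanningTree_arbEdges {N : ℕ} {w : Fin N → Fin N → ℝ} {S : Finset (Fin N)} {r : S}
    {f : S → S} (hf : IsArborescence r f) (hpos : ∀ v, v ≠ r → 0 < w (f v) v) :
    IsRootedSpanningTree w S r (arbEdges r f) where
  subgraph e he := by
    obtain ⟨v, hv, rfl⟩ := exists_of_mem_arbEdges he
    exact ⟨v.2, (f v).2, fun h => hv (hf.eq_root_of_fixed (Subtype.ext h.symm)), hpos v hv⟩
  no_antiparallel e he he' := by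
    obtain ⟨v, hv, rfl⟩ := exists_of_mem_arbEdges he
    exact hv (hf.eq_root_of_two_cycle rfl (mem_arbEdges.1 he').2)
  isTree := by
    simp only [mem_arbEdges]
    exact hf.isTree
  root_mem := r.2
  root v hv := by
    lift v to S using hv
    constructor
    · intro h
      by_contra hne
      exact h (f v) (mem_arbEdges.2 ⟨fun h => hne (congrArg _ h), rfl⟩)
    · intro h u hu
      obtain ⟨x, hx, h'⟩ := exists_of_mem_arbEdges hu
      exact hx (Subtype.ext ((Prod.ext_iff.1 h').1.symm.trans h))

/-- The definition gives each non-root vertex at least one outgoing edge. A tree has as many edges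
as non-root vertices, so one chosen outgoing edge per vertex already exhausts `T`, and out-edges are
unique. -/
theorem IsRootedSpanningTree.exists_arborescence {N : ℕ} {w : Fin N → Fin N → ℝ}
    {S : Finset (Fin N)} {r : S} {T : Finset (Fin N × Fin N)}
    (hT : IsRootedSpanningTree w S r T) :
    ∃ f : S → S, IsArborescence r f ∧ (∀ v, v ≠ r → 0 < w (f v) v) ∧ arbEdges r f = T := by
  classical
  have hout : ∀ v : S, ∃ u : S, (v ≠ r → (v.1, u.1) ∈ T) ∧ (v = r → u = r) := by
    intro v
    by_cases hv : v = r
    · exact ⟨r, fun h => absurd hv h, fun _ => rfl⟩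
    · obtain ⟨u, hu⟩ := not_forall_not.1
        (fun h => hv (Subtype.ext ((hT.root v v.2).1 h)))
      exact ⟨⟨u, (hT.subgraph _ hu).2.1⟩, fun _ => hu, fun h => absurd h hv⟩
  choose f hf hfr using hout
  have htree := hT.isTree
  set G := SimpleGraph.fromRel fun u v : S => (u.1, v.1) ∈ T
  have hadj : ∀ u v : S, (u.1, v.1) ∈ T → G.Adj u v := fun u v h => by
    rw [SimpleGraph.fromRel_adj]
    exact ⟨fun h' => (hT.subgraph _ h).2.2.1 (congrArg Subtype.val h'), Or.inl h⟩
  let e : {v : S // v ≠ r} → G.edgeSet := fun v => ⟨s(v.1, f v.1), hadj _ _ (hf v v.2)⟩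
  have he : Function.Injective e := by
    intro u v huv
    rcases Sym2.eq_iff.1 (congrArg Subtype.val huv) with h | h
    · exact Subtype.ext h.1
    · refine absurd (hf u u.2) ?_
      have := hT.no_antiparallel _ (hf v v.2)
      rwa [Prod.swap_prod_mk, ← h.1, ← h.2] at this
  have hcard : Nat.card {v : S // v ≠ r} = Nat.card G.edgeSet := by
    have h := (SimpleGraph.isTree_iff_connected_and_card.1 htree).2
    have h' : Nat.card {v : S // v ≠ r} + 1 = Nat.card S := by
      rw [Nat.card_eq_fintype_card, Nat.card_eq_fintype_card, Fintype.card_subtype_compl,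
        Fintype.card_subtype_eq]
      exact Nat.sub_add_cancel (Fintype.card_pos_iff.2 ⟨r⟩)
    omega
  have hsurj : Function.Surjective e := ((Nat.bijective_iff_injective_and_card e).2 ⟨he, hcard⟩).2
  have huniq : ∀ u v : S, (u.1, v.1) ∈ T → u ≠ r ∧ f u = v := by
    intro u v huv
    obtain ⟨x, hx⟩ := hsurj ⟨s(u, v), hadj u v huv⟩
    rcases Sym2.eq_iff.1 (congrArg Subtype.val hx) with h | h
    · exact ⟨h.1 ▸ x.2, h.1 ▸ h.2⟩
    · have := hT.no_antiparallel _ (hf x x.2)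
      rw [h.2, h.1] at this
      exact absurd huv this
  refine ⟨f, ⟨hfr r rfl, fun v => ?_⟩, fun v hv => (hT.subgraph _ (hf v hv)).2.2.2, ?_⟩
  -- Induct along an undirected path from `r`. An edge of `T` traversed forwards shortens the orbit
  -- leading to `r` by one step; one traversed backwards lengthens it by one.
  · obtain h := htree.connected.preconnected r v
    rw [SimpleGraph.reachable_iff_reflTransGen] at h
    induction h with
    | refl => exact ⟨0, rfl⟩
    | @tail u v _ huv ih =>
      obtain ⟨n, hn⟩ := ih
      rw [SimpleGraph.fromRel_adj] at huv
      rcases huv.2 with h | h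
      · obtain ⟨hu, rfl⟩ := huniq _ _ h
        rcases n with _ | n
        · exact absurd hn hu
        · exact ⟨n, hn⟩
      · obtain ⟨-, rfl⟩ := huniq _ _ h
        exact ⟨n + 1, hn⟩
  · ext ⟨a, b⟩
    constructor
    · intro h
      obtain ⟨v, hv, h⟩ := exists_of_mem_arbEdges h
      exact h ▸ hf v hv
    · intro h
      obtain ⟨ha, hb, -⟩ := hT.subgraph _ h
      lift a to S using ha
      lift b to S using hb
      exact mem_arbEdges.2 (huniq a b h)

theorem arbEdges_injOn {N : ℕ} {S : Finset (Fin N)} {r : S} {f g : S → S}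
    (hf : IsArborescence r f) (hg : IsArborescence r g) (h : arbEdges r f = arbEdges r g) :
    f = g := by
  funext v
  by_cases hv : v = r
  · rw [hv, hf.1, hg.1]
  · exact ((mem_arbEdges.1 (h ▸ mem_arbEdges.2 ⟨hv, rfl⟩ : (v.1, (f v).1) ∈ arbEdges r g)).2).symm

theorem prod_arbEdges {N : ℕ} (w : Fin N → Fin N → ℝ) {S : Finset (Fin N)} (r : S) (f : S → S) :
    ∏ e ∈ arbEdges r f, w e.2 e.1 = ∏ v ∈ Finset.univ.erase r, w (f v) v := by
  rw [arbEdges, Finset.prod_image]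
  intro u _ v _ h
  exact Subtype.ext (Prod.ext_iff.1 h).1

/-- Arborescences may use pairs of weight zero while spanning trees may not; those contribute zero,
so only nonzero terms need to correspond. -/
theorem treeWeight_eq_arbWeight {N : ℕ} {w : Fin N → Fin N → ℝ} (hw : ∀ i j, 0 ≤ w i j)
    {S : Finset (Fin N)} (r : S) :
    treeWeight w S r = arbWeight (fun a b : S => w a b) r := by
  classical
  rw [treeWeight, arbWeight]
  symm
  refine Finset.sum_bij_ne_zero (fun f _ _ => arbEdges r f) ?_ ?_ ?_ ?_
  · intro f hf hne
    rw [Finset.mem_filter] at hf ⊢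
    exact ⟨Finset.mem_univ _, isRootedSpanningTree_arbEdges hf.2 fun v hv =>
      (hw _ _).lt_of_ne' (Finset.prod_ne_zero_iff.1 hne v (by simp [hv]))⟩
  · intro f hf _ g hg _ h
    exact arbEdges_injOn (Finset.mem_filter.1 hf).2 (Finset.mem_filter.1 hg).2 h
  · intro T hT _
    obtain ⟨f, hf, hpos, rfl⟩ := (Finset.mem_filter.1 hT).2.exists_arborescence
    refine ⟨f, by simpa using hf, ?_, rfl⟩
    exact (Finset.prod_pos fun v hv => hpos v (Finset.ne_of_mem_erase hv)).ne'
  · intro f _ _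
    exact (prod_arbEdges w r f).symm

theorem treeWeight_eq_zero {N : ℕ} {w : Fin N → Fin N → ℝ} {S : Finset (Fin N)} {r : Fin N}
    (hr : r ∉ S) : treeWeight w S r = 0 := by
  classical
  rw [treeWeight, Finset.filter_false_of_mem fun T _ hT => hr hT.root_mem, Finset.sum_empty]

end QDS

/-! ### Stationary vectors of a weighted digraph -/

namespace QDS

open FunctionalGraph

/-- The vectors for which inflow and outflow agree at each vertex. -/
def stationary {N : ℕ} (w : Fin N → Fin N → ℝ) : Submodule ℂ (Fin N → ℂ) where
  carrier := {x | ∀ i, ∑ j, (w i j : ℂ) * x j = (∑ k, (w k i : ℂ)) * x i}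
  add_mem' {x y} hx hy i := by
    simp only [Pi.add_apply, mul_add, Finset.sum_add_distrib, hx i, hy i]
  zero_mem' i := by simp
  smul_mem' c x hx i := by
    simp only [Pi.smul_apply, smul_eq_mul, mul_left_comm _ c, ← Finset.mul_sum, hx i]

theorem mem_stationary {N : ℕ} {w : Fin N → Fin N → ℝ} {x : Fin N → ℂ} :
    x ∈ stationary w ↔ ∀ i, ∑ j, (w i j : ℂ) * x j = (∑ k, (w k i : ℂ)) * x i := Iff.rfl

/-- The triangle inequality gives `≤` at each vertex, and both sides have the same total over all
vertices, so equality holds everywhere. -/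
theorem sum_mul_norm_of_stationary {N : ℕ} {w : Fin N → Fin N → ℝ} (hw : ∀ i j, 0 ≤ w i j)
    {x : Fin N → ℂ} (hx : x ∈ stationary w) (i : Fin N) :
    (∑ k, w k i) * ‖x i‖ = ∑ j, w i j * ‖x j‖ := by
  have hle : ∀ i ∈ Finset.univ, (∑ k, w k i) * ‖x i‖ ≤ ∑ j, w i j * ‖x j‖ := by
    intro i _
    calc (∑ k, w k i) * ‖x i‖ = ‖(∑ k, (w k i : ℂ)) * x i‖ := by
          rw [norm_mul, ← Complex.ofReal_sum, Complex.norm_real,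
            Real.norm_of_nonneg (Finset.sum_nonneg fun k _ => hw k i)]
      _ = ‖∑ j, (w i j : ℂ) * x j‖ := by rw [hx i]
      _ ≤ ∑ j, ‖(w i j : ℂ) * x j‖ := norm_sum_le _ _
      _ = ∑ j, w i j * ‖x j‖ := by
          simp only [norm_mul, Complex.norm_real, Real.norm_of_nonneg (hw _ _)]
  refine (Finset.sum_eq_sum_iff_of_le hle).1 ?_ i (Finset.mem_univ i)
  rw [Finset.sum_comm]
  simp only [Finset.sum_mul]

/-- At a zero of `x` the inflow of norms is zero, so `x` vanishes at every vertex with an edge into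
it. -/
theorem eq_zero_of_reaches {N : ℕ} {w : Fin N → Fin N → ℝ} (hw : ∀ i j, 0 ≤ w i j)
    {x : Fin N → ℂ} (hx : x ∈ stationary w) {i j : Fin N} (h : Reaches w j i) (hi : x i = 0) :
    x j = 0 := by
  induction h using Relation.ReflTransGen.head_induction_on with
  | refl => exact hi
  | @head a b hab _ ih =>
    have h := sum_mul_norm_of_stationary hw hx b
    rw [ih, norm_zero, mul_zero, eq_comm,
      Finset.sum_eq_zero_iff_of_nonneg fun j _ => mul_nonneg (hw _ _) (norm_nonneg _)] at h
    exact norm_eq_zero.1 ((mul_eq_zero.1 (h a (Finset.mem_univ a))).resolve_left hab.2.ne')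

/-- Stationary vectors separated by a set of vertices that every vertex reaches span all stationary
vectors. -/
theorem span_eq_stationary {N : ℕ} {w : Fin N → Fin N → ℝ} (hw : ∀ i j, 0 ≤ w i j)
    {ι : Type*} [Finite ι] {d : ι → Fin N → ℂ} (hd : ∀ a, d a ∈ stationary w) (rep : ι → Fin N)
    (hrep : ∀ a, d a (rep a) ≠ 0) (hrep' : ∀ a b, a ≠ b → d a (rep b) = 0)
    (hreach : ∀ v, ∃ a, Reaches w v (rep a)) :
    Submodule.span ℂ (Set.range d) = stationary w := by
  classical
  have := Fintype.ofFinite ι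
  apply le_antisymm
  · rw [Submodule.span_le]
    rintro _ ⟨a, rfl⟩
    exact hd a
  · intro x hx
    -- `y` interpolates `x` at the representatives, so `x - y` is stationary with zeros that every
    -- vertex reaches.
    set y := ∑ a, (x (rep a) / d a (rep a)) • d a with hy
    have hyspan : y ∈ Submodule.span ℂ (Set.range d) :=
      Submodule.sum_mem _ fun a _ => Submodule.smul_mem _ _ (Submodule.subset_span ⟨a, rfl⟩)
    have hymem : y ∈ stationary w :=
      Submodule.sum_mem _ fun a _ => Submodule.smul_mem _ _ (hd a)
    have hxy : x - y = 0 := by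
      funext v
      obtain ⟨a, ha⟩ := hreach v
      refine eq_zero_of_reaches hw (Submodule.sub_mem _ hx hymem) ha ?_
      rw [Pi.sub_apply, hy, Finset.sum_apply, Finset.sum_eq_single a]
      · rw [Pi.smul_apply, smul_eq_mul, div_mul_cancel₀ _ (hrep a), sub_self]
      · intro b _ hba
        rw [Pi.smul_apply, hrep' b a hba, smul_zero]
      · exact fun h => absurd (Finset.mem_univ a) h
    rwa [sub_eq_zero.1 hxy]

/-! ### Terminal strongly connected components -/

theorem mem_scc {N : ℕ} {w : Fin N → Fin N → ℝ} {i j : Fin N} :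
    j ∈ scc w i ↔ Reaches w i j ∧ Reaches w j i := by
  simp [scc]

theorem self_mem_scc {N : ℕ} (w : Fin N → Fin N → ℝ) (i : Fin N) : i ∈ scc w i :=
  mem_scc.2 ⟨.refl, .refl⟩

theorem scc_eq {N : ℕ} {w : Fin N → Fin N → ℝ} {i j : Fin N} (h : j ∈ scc w i) :
    scc w j = scc w i := by
  rw [mem_scc] at h
  ext k
  rw [mem_scc, mem_scc]
  exact ⟨fun hk => ⟨h.1.trans hk.1, hk.2.trans h.2⟩, fun hk => ⟨h.2.trans hk.1, hk.2.trans h.1⟩⟩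

theorem IsTSCC.eq_scc {N : ℕ} {w : Fin N → Fin N → ℝ} {S : Finset (Fin N)} (hS : IsTSCC w S)
    {j : Fin N} (hj : j ∈ S) : S = scc w j := by
  obtain ⟨i, rfl, -⟩ := hS
  exact (scc_eq hj).symm

theorem IsTSCC.mem_of_reaches {N : ℕ} {w : Fin N → Fin N → ℝ} {S : Finset (Fin N)}
    (hS : IsTSCC w S) {j k : Fin N} (hj : j ∈ S) (h : Reaches w j k) : k ∈ S := by
  obtain ⟨i, rfl, hi⟩ := hS
  rw [← hi k ((mem_scc.1 hj).1.trans h)]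
  exact self_mem_scc w k

theorem IsTSCC.reaches {N : ℕ} {w : Fin N → Fin N → ℝ} {S : Finset (Fin N)}
    (hS : IsTSCC w S) {j k : Fin N} (hj : j ∈ S) (hk : k ∈ S) : Reaches w j k := by
  rw [hS.eq_scc hj] at hk
  exact (mem_scc.1 hk).1

theorem IsTSCC.weight_eq_zero {N : ℕ} {w : Fin N → Fin N → ℝ} (hw : ∀ i j, 0 ≤ w i j)
    {S : Finset (Fin N)} (hS : IsTSCC w S) {i j : Fin N} (hj : j ∈ S) (hi : i ∉ S) :
    w i j = 0 := by
  by_contra hne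
  refine hi (hS.mem_of_reaches hj (.single ⟨?_, (hw i j).lt_of_ne' hne⟩))
  rintro rfl
  exact hi hj

theorem IsTSCC.treeWeight_pos {N : ℕ} {w : Fin N → Fin N → ℝ} (hw : ∀ i j, 0 ≤ w i j)
    {S : Finset (Fin N)} (hS : IsTSCC w S) {r : Fin N} (hr : r ∈ S) : 0 < treeWeight w S r := by
  lift r to S using hr
  rw [treeWeight_eq_arbWeight hw]
  refine arbWeight_pos (fun _ _ => hw _ _) ?_
  rintro ⟨v, hv⟩
  have h := hS.reaches hv r.2
  induction h using Relation.ReflTransGen.head_induction_on with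
  | refl => exact .refl
  | @head a b hab _ ih =>
    exact .head (b := ⟨b, hS.mem_of_reaches hv (.single hab)⟩) hab.2 (ih _)

theorem treeWeight_nonneg {N : ℕ} {w : Fin N → Fin N → ℝ} (hw : ∀ i j, 0 ≤ w i j)
    (S : Finset (Fin N)) (r : Fin N) : 0 ≤ treeWeight w S r :=
  Finset.sum_nonneg fun _ _ => Finset.prod_nonneg fun _ _ => hw _ _

theorem IsTSCC.sum_treeWeight_pos {N : ℕ} {w : Fin N → Fin N → ℝ} (hw : ∀ i j, 0 ≤ w i j)
    {S : Finset (Fin N)} (hS : IsTSCC w S) : 0 < ∑ j, treeWeight w S j := by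
  obtain ⟨r, hr⟩ : ∃ r, r ∈ S := by
    obtain ⟨i, rfl, -⟩ := hS
    exact ⟨i, self_mem_scc w i⟩
  exact Finset.sum_pos' (fun j _ => treeWeight_nonneg hw S j)
    ⟨r, Finset.mem_univ r, hS.treeWeight_pos hw hr⟩

/-- No weight leaves a terminal component, so out-rates may be computed inside `S`, where the Markov
chain tree theorem applies. -/
theorem IsTSCC.treeWeight_stationary {N : ℕ} {w : Fin N → Fin N → ℝ} (hw : ∀ i j, 0 ≤ w i j)
    {S : Finset (Fin N)} (hS : IsTSCC w S) (i : Fin N) :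
    ∑ j, w i j * treeWeight w S j = (∑ k, w k i) * treeWeight w S i := by
  have hsum : ∑ j, w i j * treeWeight w S j = ∑ j ∈ S, w i j * treeWeight w S j := by
    refine (Finset.sum_subset (Finset.subset_univ S) fun j _ hj => ?_).symm
    rw [treeWeight_eq_zero hj, mul_zero]
  rw [hsum]
  by_cases hi : i ∈ S
  · have hout : ∑ k, w k i = ∑ k ∈ S, w k i :=
      (Finset.sum_subset (Finset.subset_univ S) fun k _ hk => hS.weight_eq_zero hw hi hk).symm
    rw [hout, ← Finset.sum_coe_sort S, ← Finset.sum_coe_sort S]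
    simp only [treeWeight_eq_arbWeight hw]
    lift i to S using hi
    rw [treeWeight_eq_arbWeight hw, mul_comm]
    exact (arbWeight_mul_sum (fun a b : S => w a b) i).symm
  · rw [treeWeight_eq_zero hi, mul_zero]
    exact Finset.sum_eq_zero fun j hj => by rw [hS.weight_eq_zero hw hj hi, zero_mul]

/-- Every vertex reaches a terminal strongly connected component. -/
theorem exists_isTSCC_reaches {N : ℕ} (w : Fin N → Fin N → ℝ) (v : Fin N) :
    ∃ S, IsTSCC w S ∧ ∃ i ∈ S, Reaches w v i := by
  classical
  let out : Fin N → Finset (Fin N) := fun j => Finset.univ.filter (Reaches w j)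
  have hout : ∀ j k, k ∈ out j ↔ Reaches w j k := fun j k => by simp [out]
  -- A vertex reachable from `v` with fewest reachable vertices lies in a terminal component:
  -- anything it reaches has the same reachable set, hence reaches back.
  obtain ⟨j, hj, hmin⟩ := Finset.exists_min_image (out v) (fun j => (out j).card)
    ⟨v, (hout v v).2 .refl⟩
  rw [hout] at hj
  refine ⟨scc w j, ⟨j, rfl, fun k hk => scc_eq (mem_scc.2 ⟨hk, ?_⟩)⟩, j, self_mem_scc w j, hj⟩
  have hsub : out k ⊆ out j := fun l hl => (hout j l).2 (hk.trans ((hout k l).1 hl))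
  have heq := Finset.eq_of_subset_of_card_le hsub (hmin k ((hout v k).2 (hj.trans hk)))
  exact (hout k j).1 (heq ▸ (hout j j).2 .refl)

/-- Distinct terminal components are disjoint, and tree weights are positive on their component and
zero off it, so one vertex from each separates these vectors. -/
theorem span_dTSCC {N : ℕ} {w : Fin N → Fin N → ℝ} (hw : ∀ i j, 0 ≤ w i j) :
    Submodule.span ℂ {d | ∃ S, IsTSCC w S ∧ d = dTSCC w S} =
      (stationary w).map (Matrix.diagonalLinearMap (Fin N) ℂ ℂ) := by
  let d : {S // IsTSCC w S} → Fin N → ℂ := fun S i =>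
    ((treeWeight w S i / ∑ j, treeWeight w S j : ℝ) : ℂ)
  have hnonempty : ∀ S : {S // IsTSCC w S}, ∃ r, r ∈ S.1 := by
    rintro ⟨S, i, rfl, -⟩
    exact ⟨i, self_mem_scc w i⟩
  choose rep hrep using hnonempty
  rw [← span_eq_stationary hw (d := d) ?_ rep ?_ ?_ ?_, Submodule.map_span, ← Set.range_comp]
  · congr 1
    ext D
    constructor
    · rintro ⟨S, hS, rfl⟩
      exact ⟨⟨S, hS⟩, rfl⟩
    · rintro ⟨⟨S, hS⟩, rfl⟩
      exact ⟨S, hS, rfl⟩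
  · rintro ⟨S, hS⟩ i
    simp only [d]
    rw [← Complex.ofReal_sum, ← Complex.ofReal_mul]
    simp only [← Complex.ofReal_mul]
    rw [← Complex.ofReal_sum, Complex.ofReal_inj]
    simp only [← mul_div_assoc, ← Finset.sum_div]
    rw [hS.treeWeight_stationary hw]
  · rintro ⟨S, hS⟩
    rw [Complex.ofReal_ne_zero]
    exact (div_pos (hS.treeWeight_pos hw (hrep ⟨S, hS⟩)) (hS.sum_treeWeight_pos hw)).ne'
  · rintro ⟨S, hS⟩ ⟨S', hS'⟩ hne
    have hmem : rep ⟨S', hS'⟩ ∉ S := fun h =>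
      hne (Subtype.ext ((hS.eq_scc h).trans (hS'.eq_scc (hrep ⟨S', hS'⟩)).symm))
    simp only [d, treeWeight_eq_zero hmem, zero_div, Complex.ofReal_zero]
  · intro v
    obtain ⟨S, hS, i, hi, hv⟩ := exists_isTSCC_reaches w v
    exact ⟨⟨S, hS⟩, hv.trans (hS.reaches hi (hrep ⟨S, hS⟩))⟩

/-! ### Symmetric weights -/

theorem fromRel_hasEdge_adj {N : ℕ} {w : Fin N → Fin N → ℝ} (hsymm : ∀ i j, w i j = w j i)
    {i j : Fin N} : (SimpleGraph.fromRel (HasEdge w)).Adj i j ↔ HasEdge w i j := by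
  rw [SimpleGraph.fromRel_adj, HasEdge, HasEdge, hsymm j i, ne_comm (a := j)]
  tauto

/-- With symmetric weights, indicators of components satisfy detailed balance, flow cancelling edge
by edge. -/
theorem span_dComponent {N : ℕ} {w : Fin N → Fin N → ℝ} (hw : ∀ i j, 0 ≤ w i j)
    (hsymm : ∀ i j, w i j = w j i) :
    Submodule.span ℂ (Set.range (dComponent (SimpleGraph.fromRel (HasEdge w)))) =
      (stationary w).map (Matrix.diagonalLinearMap (Fin N) ℂ ℂ) := by
  classical
  set G := SimpleGraph.fromRel (HasEdge w)
  let d : G.ConnectedComponent → Fin N → ℂ := fun K i =>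
    if G.connectedComponentMk i = K then 1 else 0
  rw [← span_eq_stationary hw (d := d) ?_ (fun K => K.out) ?_ ?_ ?_, Submodule.map_span,
    ← Set.range_comp]
  · congr 2
  · intro K i
    rw [Finset.sum_mul]
    refine Finset.sum_congr rfl fun j _ => ?_
    rw [hsymm j i]
    rcases (hw i j).eq_or_lt with h | h
    · rw [← h]
      simp
    · by_cases hij : i = j
      · rw [hij]
      · have : G.connectedComponentMk i = G.connectedComponentMk j :=
          SimpleGraph.ConnectedComponent.sound
            ((fromRel_hasEdge_adj hsymm).2 ⟨hij, hsymm i j ▸ h⟩).reachable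
        simp only [d, this]
  · intro K
    have : G.connectedComponentMk K.out = K := Quot.out_eq K
    simp [d, this]
  · intro K K' hne
    have : G.connectedComponentMk K'.out = K' := Quot.out_eq K'
    simp [d, this, hne.symm]
  · intro v
    refine ⟨G.connectedComponentMk v, ?_⟩
    have h : G.Reachable v (G.connectedComponentMk v).out :=
      SimpleGraph.ConnectedComponent.exact (Quot.out_eq (G.connectedComponentMk v)).symm
    rw [SimpleGraph.reachable_iff_reflTransGen] at h
    exact Relation.ReflTransGen.mono (fun _ _ => (fromRel_hasEdge_adj hsymm).1) _ _ h

end QDS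

/-! ### Positivity of the coefficient matrix -/

namespace QDS

/-- This evaluates Choi forms of maps `ρ ↦ X ρ Y`, and shows why one-sided multiplications disappear
at traceless matrices. -/
theorem sum_mul_single_mul_apply {N : ℕ} (X Y : Mat N) :
    ∑ i : Fin N, ∑ j : Fin N, (X * Matrix.single i j (1 : ℂ) * Y) i j = X.trace * Y.trace := by
  simp only [Matrix.trace, Matrix.diag, Finset.sum_mul_sum]
  refine Finset.sum_congr rfl fun i _ => Finset.sum_congr rfl fun j _ => ?_
  rw [Matrix.mul_apply, Finset.sum_eq_single j]
  · rw [Matrix.mul_single_apply_same, mul_one]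
  · intro k _ hk
    rw [Matrix.mul_single_apply_of_ne _ _ _ _ _ hk, zero_mul]
  · exact fun h => absurd (Finset.mem_univ j) h

/-- The quadratic form of the Choi matrix of `Φ` at `A`. -/
def choiForm {N : ℕ} (A : Mat N) (Φ : Mat N → Mat N) : ℂ :=
  ∑ i : Fin N, ∑ j : Fin N, (Aᴴ * Φ (Matrix.single i j 1) * A) i j

theorem IsCompletelyPositive.choiForm_nonneg {N : ℕ} {Φ : Mat N →ₗ[ℂ] Mat N}
    (hΦ : IsCompletelyPositive Φ) (A : Mat N) : 0 ≤ choiForm A Φ := by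
  -- The unnormalised maximally entangled vector: the blocks of its rank-one matrix are the matrix
  -- units.
  let v : Fin N × Fin N → ℂ := fun p => if p.1 = p.2 then 1 else 0
  have h := (hΦ N (Matrix.vecMulVec v (star v))
    (Matrix.posSemidef_vecMulVec_self_star v)).dotProduct_mulVec_nonneg fun p => A p.2 p.1
  convert h using 1
  have hblock : ∀ i j : Fin N, (Matrix.of fun k l => Matrix.vecMulVec v (star v) (i, k) (j, l)) =
      Matrix.single i j (1 : ℂ) := by
    intro i j
    ext k l
    simp only [Matrix.of_apply, Matrix.vecMulVec_apply, v, Pi.star_apply, Matrix.single_apply]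
    split_ifs <;> simp_all
  simp only [choiForm, Matrix.mul_assoc]
  simp only [dotProduct, Matrix.mulVec, amplify, Matrix.of_apply, hblock,
    Fintype.sum_prod_type, Matrix.mul_apply, Matrix.conjTranspose_apply,
    Pi.star_apply, Finset.mul_sum]
  exact Finset.sum_congr rfl fun i _ => Finset.sum_comm

/-- Conditional complete positivity: for traceless `A` the identity has Choi form zero, so the form
of the difference quotient is a nonnegative multiple of that of `T t`; let `t` tend to zero. -/
theorem IsQDSGenerator.choiForm_nonneg {N : ℕ} {L : Mat N →ₗ[ℂ] Mat N} (hL : IsQDSGenerator L)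
    {A : Mat N} (hA : A.trace = 0) : 0 ≤ choiForm A L := by
  obtain ⟨T, hT, hlim⟩ := hL
  have hid : choiForm A (fun x => x) = 0 := by
    rw [choiForm, sum_mul_single_mul_apply, hA, mul_zero]
  have htend : Filter.Tendsto
      (fun t : ℝ => choiForm A fun x => ((t⁻¹ : ℝ) : ℂ) • (T t x - x)) (𝓝[>] 0)
      (𝓝 (choiForm A L)) := by
    refine tendsto_finsetSum _ fun i _ => tendsto_finsetSum _ fun j _ => ?_
    have hc : Continuous fun X : Mat N => (Aᴴ * X * A) i j := by fun_prop
    exact (hc.tendsto _).comp (hlim (Matrix.single i j 1))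
  refine ge_of_tendsto htend (eventually_nhdsWithin_of_forall fun t ht => ?_)
  have hsplit : (choiForm A fun x => ((t⁻¹ : ℝ) : ℂ) • (T t x - x)) =
      ((t⁻¹ : ℝ) : ℂ) * (choiForm A (T t) - choiForm A fun x => x) := by
    simp only [choiForm, mul_sub, Finset.mul_sum, ← Finset.sum_sub_distrib, Matrix.mul_smul,
      Matrix.smul_mul, Matrix.sub_mul, Matrix.smul_apply, Matrix.sub_apply,
      smul_eq_mul]
  rw [hsplit, hid, sub_zero]
  exact mul_nonneg (Complex.zero_le_real.2 (inv_nonneg.2 (le_of_lt ht)))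
    ((hT.completelyPositive t (le_of_lt ht)).choiForm_nonneg A)

/-- The Hamiltonian and anticommutator terms have the shape $K\rho+\rho K'$ and contribute a factor
$\operatorname{tr}A$ or $\operatorname{tr}A^*$. Only the terms $\lambda_p\rho\lambda_q$ survive. -/
theorem choiForm_gellMannForm {N : ℕ} (H : Mat N) (C : Matrix (GMIndex N) (GMIndex N) ℂ)
    {A : Mat N} (hA : A.trace = 0) :
    choiForm A (gellMannForm H C) =
      ∑ p, ∑ q, C p q * ((Aᴴ * lam p).trace * (lam q * A).trace) := by
  have hA' : Aᴴ.trace = 0 := by rw [Matrix.trace_conjTranspose, hA, star_zero]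
  set K : Mat N := -(Complex.I • H) - (1 / 2 : ℂ) • ∑ p, ∑ q, C p q • (lam q * lam p)
  set K' : Mat N := Complex.I • H - (1 / 2 : ℂ) • ∑ p, ∑ q, C p q • (lam q * lam p)
  have hform : ∀ ρ, gellMannForm H C ρ =
      K * ρ + ρ * K' + ∑ p, ∑ q, C p q • (lam p * ρ * lam q) := by
    intro ρ
    have : ∀ p q : GMIndex N, C p q • (⁅lam p, ρ * lam q⁆ + ⁅lam p * ρ, lam q⁆) =
        (2 : ℂ) • (C p q • (lam p * ρ * lam q)) - ρ * (C p q • (lam q * lam p)) -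
          (C p q • (lam q * lam p)) * ρ := by
      intro p q
      simp only [Ring.lie_def, Matrix.mul_smul, Matrix.smul_mul, Matrix.mul_assoc]
      module
    rw [gellMannForm]
    simp only [this]
    simp only [Finset.sum_sub_distrib, ← Finset.smul_sum, Matrix.mul_sum,
      Matrix.sum_mul, K, K', Ring.lie_def, Matrix.sub_mul, Matrix.mul_sub, Matrix.smul_mul,
      Matrix.mul_smul, Matrix.neg_mul]
    module
  have hsplit : choiForm A (gellMannForm H C) =
      (∑ i : Fin N, ∑ j : Fin N, (Aᴴ * K * Matrix.single i j (1 : ℂ) * A) i j +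
        ∑ i : Fin N, ∑ j : Fin N, (Aᴴ * Matrix.single i j (1 : ℂ) * (K' * A)) i j) +
      ∑ p, ∑ q, C p q *
        ∑ i : Fin N, ∑ j : Fin N, (Aᴴ * lam p * Matrix.single i j (1 : ℂ) * (lam q * A)) i j := by
    have hcomm : ∑ p, ∑ q, C p q *
        ∑ i : Fin N, ∑ j : Fin N, (Aᴴ * lam p * Matrix.single i j (1 : ℂ) * (lam q * A)) i j =
        ∑ i : Fin N, ∑ j : Fin N, ∑ p, ∑ q,
          C p q * (Aᴴ * lam p * Matrix.single i j (1 : ℂ) * (lam q * A)) i j := by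
      simp only [Finset.mul_sum]
      simp only [Finset.sum_comm (s := (Finset.univ : Finset (GMIndex N)))
        (t := (Finset.univ : Finset (Fin N)))]
    rw [hcomm, choiForm]
    simp only [← Finset.sum_add_distrib]
    refine Finset.sum_congr rfl fun i _ => Finset.sum_congr rfl fun j _ => ?_
    rw [hform]
    simp only [Matrix.mul_add, Matrix.add_mul, Matrix.add_apply, Matrix.mul_sum, Matrix.sum_mul,
      Matrix.sum_apply, Matrix.mul_smul, Matrix.smul_mul, Matrix.smul_apply, smul_eq_mul,
      Matrix.mul_assoc]
  rw [hsplit]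
  simp only [sum_mul_single_mul_apply, hA, hA', mul_zero, zero_mul, add_zero, zero_add]

end QDS

namespace QDS

/-! ### Entries of the Gell-Mann matrices -/

/-- `1 / √2` as a complex number. -/
noncomputable def invSqrtTwo : ℂ := ((1 / Real.sqrt 2 : ℝ) : ℂ)

theorem invSqrtTwo_mul_self : invSqrtTwo * invSqrtTwo = 1 / 2 := by
  rw [invSqrtTwo, ← Complex.ofReal_mul, div_mul_div_comm, Real.mul_self_sqrt zero_le_two]
  norm_num

theorem star_invSqrtTwo : star invSqrtTwo = invSqrtTwo := Complex.conj_ofReal _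

theorem lamOff_of_lt {N : ℕ} {i j : Fin N} (h : i < j) :
    lamOff i j = invSqrtTwo • (Matrix.single i j 1 + Matrix.single j i 1) := by
  rw [lamOff, if_pos h, invSqrtTwo]

theorem lamOff_of_gt {N : ℕ} {i j : Fin N} (h : i < j) :
    lamOff j i = (-Complex.I * invSqrtTwo) • (Matrix.single i j 1 - Matrix.single j i 1) := by
  rw [lamOff, if_neg h.not_gt, invSqrtTwo]

theorem lamOff_isHermitian {N : ℕ} (i j : Fin N) : (lamOff i j)ᴴ = lamOff i j := by
  rcases lt_or_ge i j with h | h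
  · rw [lamOff_of_lt h, Matrix.conjTranspose_smul, Matrix.conjTranspose_add,
      Matrix.conjTranspose_single, Matrix.conjTranspose_single, star_invSqrtTwo, star_one, add_comm]
  · rw [lamOff, if_neg h.not_gt, Matrix.conjTranspose_smul, Matrix.conjTranspose_sub,
      Matrix.conjTranspose_single, Matrix.conjTranspose_single, star_one, ← invSqrtTwo, star_mul,
      star_neg, star_invSqrtTwo, Complex.star_def, Complex.conj_I]
    module

/-- The diagonal entries of `lamDiag n`. -/
noncomputable def diagEntry {N : ℕ} (n : Fin (N - 1)) (m : Fin N) : ℝ :=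
  1 / Real.sqrt (((n : ℝ) + 1) * ((n : ℝ) + 2)) *
    if (m : ℕ) ≤ (n : ℕ) then 1 else if (m : ℕ) = (n : ℕ) + 1 then -((n : ℝ) + 1) else 0

theorem lamDiag_eq_diagonal {N : ℕ} (n : Fin (N - 1)) :
    (lamDiag n : Mat N) = Matrix.diagonal fun m => (diagEntry n m : ℂ) := by
  rw [lamDiag, ← Matrix.diagonal_smul]
  congr 1
  funext m
  rw [Pi.smul_apply, smul_eq_mul, diagEntry, Complex.ofReal_mul]
  congr 1
  split_ifs <;> simp

theorem lamDiag_isHermitian {N : ℕ} (n : Fin (N - 1)) : (lamDiag n : Mat N)ᴴ = lamDiag n := by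
  rw [lamDiag_eq_diagonal, Matrix.diagonal_conjTranspose]
  congr 1
  funext m
  exact Complex.conj_ofReal _

theorem sqrt_factor_pos (n : ℕ) : 0 < 1 / Real.sqrt (((n : ℝ) + 1) * ((n : ℝ) + 2)) := by
  positivity

/-- Up to scale the diagonal is `1` up to position `n`, `-(n + 1)` at `n + 1` and `0` beyond, three
distinct values; two entries agree only if both positions precede or both follow `n + 1`. This is
the source of the index range in `DiagVanishes`. -/
theorem diagEntry_eq_iff {N : ℕ} {n : Fin (N - 1)} {k l : Fin N} (hkl : k < l) :
    diagEntry n k = diagEntry n l ↔ ¬ ((k : ℕ) ≤ (n : ℕ) + 1 ∧ (n : ℕ) + 1 ≤ (l : ℕ)) := by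
  have hkl' : (k : ℕ) < l := hkl
  have hn : (0 : ℝ) ≤ (n : ℕ) := Nat.cast_nonneg _
  rw [diagEntry, diagEntry, mul_right_inj' (sqrt_factor_pos n).ne']
  split_ifs <;> constructor <;> intro h <;> first | omega | linarith

theorem sum_ite_le_succ {N : ℕ} (n : Fin (N - 1)) :
    ∑ m : Fin N, (if (m : ℕ) ≤ (n : ℕ) then (1 : ℝ)
      else if (m : ℕ) = (n : ℕ) + 1 then -((n : ℝ) + 1) else 0) = 0 := by
  have hn := n.2
  rw [Fin.sum_univ_eq_sum_range (fun m : ℕ => if m ≤ (n : ℕ) then (1 : ℝ)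
      else if m = (n : ℕ) + 1 then -((n : ℝ) + 1) else 0) N,
    ← Finset.sum_subset (Finset.range_subset_range.2 (by omega : (n : ℕ) + 2 ≤ N)),
    Finset.sum_range_succ, Finset.sum_congr rfl (g := fun _ => (1 : ℝ))]
  · simp
  · intro m hm
    rw [if_pos (by simpa [Nat.lt_succ_iff] using hm)]
  · intro m _ hm
    rw [Finset.mem_range] at hm
    rw [if_neg (by omega), if_neg (by omega)]

theorem sum_diagEntry {N : ℕ} (n : Fin (N - 1)) : ∑ m : Fin N, diagEntry n m = 0 := by
  simp only [diagEntry]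
  rw [← Finset.mul_sum, sum_ite_le_succ, mul_zero]

theorem trace_lamDiag {N : ℕ} (n : Fin (N - 1)) : (lamDiag n : Mat N).trace = 0 := by
  rw [lamDiag_eq_diagonal, Matrix.trace_diagonal, ← Complex.ofReal_sum, sum_diagEntry,
    Complex.ofReal_zero]

/-- The later diagonal is constant on the support of the earlier one, which is traceless. -/
theorem sum_diagEntry_mul_of_lt {N : ℕ} {n n' : Fin (N - 1)} (h : n < n') :
    ∑ m : Fin N, diagEntry n m * diagEntry n' m = 0 := by
  have h' : (n : ℕ) < n' := h
  calc ∑ m : Fin N, diagEntry n m * diagEntry n' m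
      = ∑ m : Fin N, diagEntry n m * (1 / Real.sqrt (((n' : ℝ) + 1) * ((n' : ℝ) + 2))) := by
        refine Finset.sum_congr rfl fun m _ => ?_
        by_cases hm : (m : ℕ) ≤ n'
        · simp only [diagEntry, if_pos hm, mul_one]
        · have : diagEntry n m = 0 := by
            rw [diagEntry, if_neg (by omega), if_neg (by omega), mul_zero]
          rw [this, zero_mul, zero_mul]
    _ = 0 := by rw [← Finset.sum_mul, sum_diagEntry, zero_mul]

theorem trace_lamDiag_mul_lamDiag {N : ℕ} {n n' : Fin (N - 1)} (h : n ≠ n') :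
    (lamDiag n * lamDiag n' : Mat N).trace = 0 := by
  rw [lamDiag_eq_diagonal, lamDiag_eq_diagonal, Matrix.diagonal_mul_diagonal,
    Matrix.trace_diagonal]
  simp only [← Complex.ofReal_mul]
  rw [← Complex.ofReal_sum, Complex.ofReal_eq_zero]
  rcases lt_or_gt_of_ne h with h | h
  · exact sum_diagEntry_mul_of_lt h
  · simpa only [mul_comm] using sum_diagEntry_mul_of_lt h

theorem trace_lamDiag_mul_self_ne_zero {N : ℕ} (n : Fin (N - 1)) :
    (lamDiag n * lamDiag n : Mat N).trace ≠ 0 := by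
  rw [lamDiag_eq_diagonal, Matrix.diagonal_mul_diagonal, Matrix.trace_diagonal]
  simp only [← Complex.ofReal_mul]
  rw [← Complex.ofReal_sum, Complex.ofReal_ne_zero]
  have hn := n.2
  refine (Finset.sum_pos' (fun m _ => mul_self_nonneg _)
    ⟨⟨n, by omega⟩, Finset.mem_univ _, mul_self_pos.2 ?_⟩).ne'
  rw [diagEntry, if_pos le_rfl, mul_one]
  exact (sqrt_factor_pos n).ne'

theorem trace_single_mul {N : ℕ} (i j : Fin N) (A : Mat N) :
    (Matrix.single i j (1 : ℂ) * A).trace = A j i := by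
  rw [Matrix.trace_mul_comm, Matrix.trace_mul_single]
  simp

theorem trace_lamOff_mul_of_lt {N : ℕ} {i j : Fin N} (h : i < j) (A : Mat N) :
    (lamOff i j * A).trace = invSqrtTwo * (A j i + A i j) := by
  rw [lamOff_of_lt h, Matrix.smul_mul, Matrix.trace_smul, Matrix.add_mul, Matrix.trace_add,
    trace_single_mul, trace_single_mul, smul_eq_mul]

theorem trace_lamOff_mul_of_gt {N : ℕ} {i j : Fin N} (h : i < j) (A : Mat N) :
    (lamOff j i * A).trace = -Complex.I * invSqrtTwo * (A j i - A i j) := by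
  rw [lamOff_of_gt h, Matrix.smul_mul, Matrix.trace_smul, Matrix.sub_mul, Matrix.trace_sub,
    trace_single_mul, trace_single_mul, smul_eq_mul]

theorem trace_lamOff_mul_eq_zero {N : ℕ} {i j : Fin N} {A : Mat N} (hij : i ≠ j)
    (h : A i j = 0) (h' : A j i = 0) : (lamOff i j * A).trace = 0 := by
  rcases lt_or_gt_of_ne hij with hlt | hlt
  · rw [trace_lamOff_mul_of_lt hlt, h, h', add_zero, mul_zero]
  · rw [trace_lamOff_mul_of_gt hlt, h, h', sub_zero, mul_zero]

/-- The matrix `x λ_{kl} + y λ_{lk}`. -/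
noncomputable def pairComb {N : ℕ} (k l : Fin N) (x y : ℂ) : Mat N :=
  x • lamOff k l + y • lamOff l k

theorem pairComb_eq {N : ℕ} {k l : Fin N} (h : k < l) (x y : ℂ) :
    pairComb k l x y = Matrix.single k l (invSqrtTwo * (x - Complex.I * y)) +
      Matrix.single l k (invSqrtTwo * (x + Complex.I * y)) := by
  have h1 : ∀ (i j : Fin N) (c : ℂ), Matrix.single i j c = c • Matrix.single i j (1 : ℂ) :=
    fun i j c => by rw [Matrix.smul_single, smul_eq_mul, mul_one]
  rw [pairComb, lamOff_of_lt h, lamOff_of_gt h, h1 k l (_ * _), h1 l k (_ * _)]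
  module

theorem pairComb_apply_left {N : ℕ} {k l : Fin N} (h : k < l) (x y : ℂ) :
    pairComb k l x y k l = invSqrtTwo * (x - Complex.I * y) := by
  rw [pairComb_eq h, Matrix.add_apply, Matrix.single_apply_same,
    Matrix.single_apply_of_ne _ _ _ _ _ (fun h' => h.ne' h'.1), add_zero]

theorem pairComb_apply_right {N : ℕ} {k l : Fin N} (h : k < l) (x y : ℂ) :
    pairComb k l x y l k = invSqrtTwo * (x + Complex.I * y) := by
  rw [pairComb_eq h, Matrix.add_apply, Matrix.single_apply_same,
    Matrix.single_apply_of_ne _ _ _ _ _ (fun h' => h.ne h'.1), zero_add]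

theorem pairComb_apply_of_ne {N : ℕ} {k l : Fin N} (h : k < l) (x y : ℂ) {i j : Fin N}
    (h1 : ¬ (i = k ∧ j = l)) (h2 : ¬ (i = l ∧ j = k)) : pairComb k l x y i j = 0 := by
  rw [pairComb_eq h, Matrix.add_apply,
    Matrix.single_apply_of_ne _ _ _ _ _ (fun h' => h1 ⟨h'.1.symm, h'.2.symm⟩),
    Matrix.single_apply_of_ne _ _ _ _ _ (fun h' => h2 ⟨h'.1.symm, h'.2.symm⟩), zero_add]

theorem trace_lamOff_mul_pairComb_left {N : ℕ} {k l : Fin N} (h : k < l) (x y : ℂ) :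
    (lamOff k l * pairComb k l x y).trace = x := by
  rw [trace_lamOff_mul_of_lt h, pairComb_apply_left h, pairComb_apply_right h]
  linear_combination 2 * x * invSqrtTwo_mul_self

theorem trace_lamOff_mul_pairComb_right {N : ℕ} {k l : Fin N} (h : k < l) (x y : ℂ) :
    (lamOff l k * pairComb k l x y).trace = y := by
  rw [trace_lamOff_mul_of_gt h, pairComb_apply_left h, pairComb_apply_right h]
  linear_combination -2 * Complex.I * Complex.I * y * invSqrtTwo_mul_self - y * Complex.I_mul_I

/-! ### Reduction of the coefficient sum to the nonzero entries -/

/-- The complex entry of `C` at the off-diagonal label `(i, j)`. -/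
noncomputable def cSelf {N : ℕ} (C : Matrix (GMIndex N) (GMIndex N) ℂ) (i j : Fin N) : ℂ :=
  if hij : i ≠ j then C (Sum.inl ⟨(i, j), hij⟩) (Sum.inl ⟨(i, j), hij⟩) else 0

theorem cSelf_re {N : ℕ} (C : Matrix (GMIndex N) (GMIndex N) ℂ) (i j : Fin N) :
    (cSelf C i j).re = cOff C i j := by
  rw [cSelf, cOff]
  split_ifs <;> simp

/-- The target `M` is left general because the reduction is needed both for the scalar Choi form and
for the matrix-valued Lindblad terms. -/
theorem sum_coeff_smul {N : ℕ} {C : Matrix (GMIndex N) (GMIndex N) ℂ}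
    (hOD : C.toBlocks₁₂ = 0) (hDO : C.toBlocks₂₁ = 0)
    (hO : IsPairBlockDiagonal C.toBlocks₁₁) (hD : C.toBlocks₂₂.IsDiag)
    {M : Type*} [AddCommGroup M] [Module ℂ M] (F : Mat N → Mat N → M) :
    ∑ p, ∑ q, C p q • F (lam p) (lam q) =
      ∑ i : Fin N, ∑ j : Fin N, (cSelf C i j • F (lamOff i j) (lamOff i j) +
        cPair C i j • F (lamOff i j) (lamOff j i)) +
      ∑ n, C (Sum.inr n) (Sum.inr n) • F (lamDiag n) (lamDiag n) := by
  have h12 : ∀ p n, C (Sum.inl p) (Sum.inr n) = 0 := fun p n => congrFun (congrFun hOD p) n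
  have h21 : ∀ p n, C (Sum.inr n) (Sum.inl p) = 0 := fun p n => congrFun (congrFun hDO n) p
  simp only [Fintype.sum_sum_type, h12, h21, zero_smul, Finset.sum_const_zero, add_zero, zero_add]
  congr 1
  · have hterm : ∀ p : OffIndex N,
        ∑ q : OffIndex N, C (Sum.inl p) (Sum.inl q) • F (lam (Sum.inl p)) (lam (Sum.inl q)) =
        cSelf C p.1.1 p.1.2 • F (lamOff p.1.1 p.1.2) (lamOff p.1.1 p.1.2) +
          cPair C p.1.1 p.1.2 • F (lamOff p.1.1 p.1.2) (lamOff p.1.2 p.1.1) := by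
      rintro ⟨⟨i, j⟩, hij⟩
      simp only [ne_eq] at hij
      rw [Fintype.sum_eq_add (⟨(i, j), hij⟩ : OffIndex N) ⟨(j, i), fun h => hij h.symm⟩]
      · simp only [cSelf, cPair, ne_eq, hij, not_false_eq_true, dif_pos, lam]
      · intro h
        exact hij (congrArg (fun q : OffIndex N => q.1.1) h)
      · rintro q ⟨hq, hq'⟩
        have : C (Sum.inl ⟨(i, j), hij⟩) (Sum.inl q) = 0 :=
          hO ⟨(i, j), hij⟩ q hq fun h => hq' (Subtype.ext h)
        rw [this, zero_smul]
    rw [Finset.sum_congr rfl fun p _ => hterm p, ← Fintype.sum_prod_type']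
    rw [← Finset.sum_subtype (Finset.univ.filter fun p : Fin N × Fin N => p.1 ≠ p.2) (by simp)
      (fun p : Fin N × Fin N => cSelf C p.1 p.2 • F (lamOff p.1 p.2) (lamOff p.1 p.2) +
          cPair C p.1 p.2 • F (lamOff p.1 p.2) (lamOff p.2 p.1))]
    refine Finset.sum_filter_of_ne ?_
    rintro ⟨i, j⟩ _ hne (h : i = j)
    subst h
    exact hne (by simp [cSelf, cPair])
  · refine Finset.sum_congr rfl fun n _ => ?_
    rw [Finset.sum_eq_single n]
    · rfl
    · intro m _ hm
      have : C (Sum.inr n) (Sum.inr m) = 0 := hD hm.symm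
      rw [this, zero_smul]
    · exact fun h => absurd (Finset.mem_univ n) h

/-! ### Positivity of the blocks of $C$ -/

/-- What positive semidefiniteness says about the entries of a pair block diagonal `C`. -/
structure IsPairPositive {N : ℕ} (C : Matrix (GMIndex N) (GMIndex N) ℂ) : Prop where
  self : ∀ i j, cSelf C i j = cOff C i j
  nonneg : ∀ i j, 0 ≤ cOff C i j
  pair : ∀ i j, cPair C j i = star (cPair C i j)
  det : ∀ i j, Complex.normSq (cPair C i j) ≤ cOff C i j * cOff C j i
  diag : ∀ n, 0 ≤ C (Sum.inr n) (Sum.inr n)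

theorem entries_of_nonneg {p q z z' : ℂ}
    (h : ∀ x y : ℂ, 0 ≤ p * (star x * x) + z * (star x * y) + (q * (star y * y) +
      z' * (star y * x))) :
    p.im = 0 ∧ q.im = 0 ∧ 0 ≤ p.re ∧ 0 ≤ q.re ∧ z' = star z ∧
      Complex.normSq z ≤ p.re * q.re := by
  have h1 := Complex.nonneg_iff.1 (h 1 0)
  have h2 := Complex.nonneg_iff.1 (h 0 1)
  -- Nonnegativity in `ℂ` includes being real; the vectors `(1, 1)` and `(1, I)` thus force `z' =
  -- star z`.
  have h3 := Complex.nonneg_iff.1 (h 1 1)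
  have h4 := Complex.nonneg_iff.1 (h 1 Complex.I)
  simp at h1 h2 h3 h4
  have hp : p.im = 0 := h1.2.symm
  have hq : q.im = 0 := h2.2.symm
  have hz : z' = star z := by
    apply Complex.ext
    · simp
      linarith [h4.2]
    · simp
      linarith [h3.2]
  refine ⟨hp, hq, h1.1, h2.1, hz, ?_⟩
  -- These vectors give $p(pq-|z|^2)\ge0$, $q(pq-|z|^2)\ge0$ and, when $p=q=0$, $-2|z|^2\ge0$,
  -- covering all cases.
  have h5 := (Complex.nonneg_iff.1 (h (-z) p)).1
  have h6 := (Complex.nonneg_iff.1 (h q (-star z))).1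
  have h7 := (Complex.nonneg_iff.1 (h z (-1))).1
  rw [hz] at h5 h6 h7
  simp [hp, hq] at h5 h6 h7
  rw [Complex.normSq_apply]
  rcases h1.1.eq_or_lt with hp0 | hp0
  · rcases h2.1.eq_or_lt with hq0 | hq0
    · rw [← hp0, ← hq0] at h7
      rw [← hp0]
      nlinarith
    · refine le_of_mul_le_mul_left ?_ hq0
      nlinarith
  · refine le_of_mul_le_mul_left ?_ hp0
    nlinarith

/-- By orthogonality of the Gell-Mann matrices, the Choi form at a combination of
$\lambda_{k\ell},\lambda_{\ell k}$ is the quadratic form of one $2\times2$ block, and at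
$\lambda_{nn}$ it is a positive multiple of $c_{nn}$. -/
theorem IsQDSGenerator.isPairPositive {N : ℕ} {L : Mat N →ₗ[ℂ] Mat N} {H : Mat N}
    {C : Matrix (GMIndex N) (GMIndex N) ℂ} (hL : IsQDSGenerator L)
    (hform : ∀ ρ, L ρ = gellMannForm H C ρ)
    (hOD : C.toBlocks₁₂ = 0) (hDO : C.toBlocks₂₁ = 0)
    (hO : IsPairBlockDiagonal C.toBlocks₁₁) (hD : C.toBlocks₂₂.IsDiag) : IsPairPositive C := by
  have hquad : ∀ A : Mat N, A.trace = 0 →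
      0 ≤ ∑ i : Fin N, ∑ j : Fin N,
        (cSelf C i j * (star (lamOff i j * A).trace * (lamOff i j * A).trace) +
          cPair C i j * (star (lamOff i j * A).trace * (lamOff j i * A).trace)) +
        ∑ n, C (Sum.inr n) (Sum.inr n) *
          (star (lamDiag n * A).trace * (lamDiag n * A).trace) := by
    intro A hA
    have h := hL.choiForm_nonneg hA
    rw [show (L : Mat N → Mat N) = gellMannForm H C from funext hform,
      choiForm_gellMannForm H C hA] at h
    have h' := sum_coeff_smul hOD hDO hO hD
      fun X Y => (Aᴴ * X).trace * (Y * A).trace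
    simp only [smul_eq_mul] at h'
    rw [h'] at h
    have hstar : ∀ X : Mat N, Xᴴ = X → (Aᴴ * X).trace = star (X * A).trace := by
      intro X hX
      rw [← Matrix.trace_conjTranspose, Matrix.conjTranspose_mul, hX]
    simpa only [hstar _ (lamOff_isHermitian _ _), hstar _ (lamDiag_isHermitian _)] using h
  have hpair : ∀ k l : Fin N, k < l → (cSelf C k l).im = 0 ∧ (cSelf C l k).im = 0 ∧
      0 ≤ (cSelf C k l).re ∧ 0 ≤ (cSelf C l k).re ∧ cPair C l k = star (cPair C k l) ∧
      Complex.normSq (cPair C k l) ≤ (cSelf C k l).re * (cSelf C l k).re := by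
    intro k l hkl
    refine entries_of_nonneg fun x y => ?_
    have hdiag : ∀ i, pairComb k l x y i i = 0 := fun i =>
      pairComb_apply_of_ne hkl x y (fun h => hkl.ne (h.1.symm.trans h.2))
        fun h => hkl.ne (h.2.symm.trans h.1)
    have h := hquad (pairComb k l x y) (Finset.sum_eq_zero fun i _ => hdiag i)
    rw [← Fintype.sum_prod_type', Fintype.sum_eq_add (k, l) (l, k),
      Finset.sum_eq_zero (s := Finset.univ) (f := fun n => C (Sum.inr n) (Sum.inr n) * _),
      add_zero] at h
    · simpa only [trace_lamOff_mul_pairComb_left hkl, trace_lamOff_mul_pairComb_right hkl] using h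
    · intro n _
      have : (lamDiag n * pairComb k l x y).trace = 0 := by
        rw [lamDiag_eq_diagonal]
        refine Finset.sum_eq_zero fun i _ => ?_
        rw [Matrix.diag_apply, Matrix.diagonal_mul, hdiag, mul_zero]
      rw [this, mul_zero, mul_zero]
    · exact fun h => hkl.ne (congrArg Prod.fst h)
    · rintro ⟨i, j⟩ ⟨h1, h2⟩
      by_cases hij : i = j
      · subst hij
        simp [cSelf, cPair]
      · rw [trace_lamOff_mul_eq_zero hij, star_zero, zero_mul, zero_mul, mul_zero, mul_zero,
          add_zero]
        · exact pairComb_apply_of_ne hkl x y (fun h => h1 (Prod.ext h.1 h.2))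
            fun h => h2 (Prod.ext h.1 h.2)
        · exact pairComb_apply_of_ne hkl x y (fun h => h2 (Prod.ext h.2 h.1))
            fun h => h1 (Prod.ext h.2 h.1)
  simp only [cSelf_re] at hpair
  have hself : ∀ i : Fin N, cSelf C i i = 0 ∧ cOff C i i = 0 ∧ cPair C i i = 0 := fun i => by
    simp [cSelf, cOff, cPair]
  refine ⟨fun i j => ?_, fun i j => ?_, fun i j => ?_, fun i j => ?_, fun n => ?_⟩
  · rcases lt_trichotomy i j with h | rfl | h
    · exact Complex.ext (cSelf_re C i j) (hpair i j h).1
    · rw [(hself i).1, (hself i).2.1, Complex.ofReal_zero]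
    · exact Complex.ext (cSelf_re C i j) (hpair j i h).2.1
  · rcases lt_trichotomy i j with h | rfl | h
    · exact (hpair i j h).2.2.1
    · exact (hself i).2.1.ge
    · exact (hpair j i h).2.2.2.1
  · rcases lt_trichotomy i j with h | rfl | h
    · exact (hpair i j h).2.2.2.2.1
    · rw [(hself i).2.2, star_zero]
    · rw [(hpair j i h).2.2.2.2.1, star_star]
  · rcases lt_trichotomy i j with h | rfl | h
    · exact (hpair i j h).2.2.2.2.2
    · rw [(hself i).2.2, (hself i).2.1, map_zero, mul_zero]
    · rw [(hpair j i h).2.2.2.2.1, Complex.star_def, Complex.normSq_conj, mul_comm]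
      exact (hpair j i h).2.2.2.2.2
  · have h := hquad (lamDiag n) (trace_lamDiag n)
    rw [Finset.sum_eq_zero (s := Finset.univ) (f := fun i : Fin N => ∑ j : Fin N, _), zero_add,
      Finset.sum_eq_single n] at h
    · have hpos := Complex.normSq_pos.2 (trace_lamDiag_mul_self_ne_zero n)
      rw [Complex.star_def, ← Complex.normSq_eq_conj_mul_self, Complex.nonneg_iff,
        Complex.re_mul_ofReal, Complex.im_mul_ofReal] at h
      exact Complex.nonneg_iff.2 ⟨nonneg_of_mul_nonneg_left h.1 hpos,
        ((mul_eq_zero.1 h.2.symm).resolve_right hpos.ne').symm⟩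
    · intro m _ hm
      rw [trace_lamDiag_mul_lamDiag hm, mul_zero, mul_zero]
    · exact fun h => absurd (Finset.mem_univ n) h
    · intro i _
      refine Finset.sum_eq_zero fun j _ => ?_
      by_cases hij : i = j
      · subst hij
        simp [cSelf, cPair]
      · rw [trace_lamOff_mul_eq_zero hij, star_zero, zero_mul, zero_mul, mul_zero, mul_zero,
          add_zero]
        · rw [lamDiag_eq_diagonal, Matrix.diagonal_apply_ne _ hij]
        · rw [lamDiag_eq_diagonal, Matrix.diagonal_apply_ne _ (Ne.symm hij)]

end QDS

namespace QDS

/-! ### The generator in the standard basis -/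

/-- The coefficient of `L` that takes the entry at `(j, i)` to the entry at `(i, j)`. -/
noncomputable def kappa {N : ℕ} (C : Matrix (GMIndex N) (GMIndex N) ℂ) (i j : Fin N) : ℂ :=
  if i < j then (cOff C i j - cOff C j i - 2 * Complex.I * aOff C i j) / 2
  else if j < i then (cOff C j i - cOff C i j + 2 * Complex.I * aOff C j i) / 2
  else 0

/-- Total weight of the edges originating from `i`. -/
noncomputable def outRate {N : ℕ} (C : Matrix (GMIndex N) (GMIndex N) ℂ) (i : Fin N) : ℝ :=
  ∑ j, gamma C j i

/-- Decay rate of the entry at `(i, j)` caused by the diagonal Gell-Mann matrices. -/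
noncomputable def dephasing {N : ℕ} (C : Matrix (GMIndex N) (GMIndex N) ℂ) (i j : Fin N) : ℝ :=
  (∑ n, (C (Sum.inr n) (Sum.inr n)).re * (diagEntry n i - diagEntry n j) ^ 2) / 2

theorem gamma_self {N : ℕ} (C : Matrix (GMIndex N) (GMIndex N) ℂ) (i : Fin N) :
    gamma C i i = 0 := by
  rw [gamma, if_neg (lt_irrefl i), if_neg (lt_irrefl i)]

theorem gamma_of_lt {N : ℕ} (C : Matrix (GMIndex N) (GMIndex N) ℂ) {i j : Fin N} (h : i < j) :
    gamma C i j = (cOff C i j + cOff C j i - 2 * bOff C i j) / 2 := by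
  rw [gamma, if_pos h]

theorem gamma_of_gt {N : ℕ} (C : Matrix (GMIndex N) (GMIndex N) ℂ) {i j : Fin N} (h : i < j) :
    gamma C j i = (cOff C i j + cOff C j i + 2 * bOff C i j) / 2 := by
  rw [gamma, if_neg h.not_gt, if_pos h]

theorem kappa_self {N : ℕ} (C : Matrix (GMIndex N) (GMIndex N) ℂ) (i : Fin N) :
    kappa C i i = 0 := by
  rw [kappa, if_neg (lt_irrefl i), if_neg (lt_irrefl i)]

theorem kappa_of_lt {N : ℕ} (C : Matrix (GMIndex N) (GMIndex N) ℂ) {i j : Fin N} (h : i < j) :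
    kappa C i j = (cOff C i j - cOff C j i - 2 * Complex.I * aOff C i j) / 2 := by
  rw [kappa, if_pos h]

theorem kappa_of_gt {N : ℕ} (C : Matrix (GMIndex N) (GMIndex N) ℂ) {i j : Fin N} (h : i < j) :
    kappa C j i = (cOff C i j - cOff C j i + 2 * Complex.I * aOff C i j) / 2 := by
  rw [kappa, if_neg h.not_gt, if_pos h]

/-- The change to matrix units mixes the labels $(i,j)$ and $(j,i)$, so the two double sums agree
only after swapped terms are paired. -/
theorem sum_sum_eq_of_symm {ι M : Type*} [Fintype ι] [LinearOrder ι] [AddCommGroup M]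
    [Module ℂ M] {f g : ι → ι → M} (hdiag : ∀ i, f i i = g i i)
    (hlt : ∀ i j, i < j → f i j + f j i = g i j + g j i) :
    ∑ i, ∑ j, f i j = ∑ i, ∑ j, g i j := by
  have hsymm : ∀ i j, f i j + f j i = g i j + g j i := by
    intro i j
    rcases lt_trichotomy i j with h | rfl | h
    · exact hlt i j h
    · rw [hdiag]
    · rw [add_comm, hlt j i h, add_comm]
  have hdouble : ∀ f : ι → ι → M, (2 : ℂ) • ∑ i, ∑ j, f i j = ∑ i, ∑ j, (f i j + f j i) := by
    intro f
    simp only [Finset.sum_add_distrib]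
    rw [two_smul, Finset.sum_comm (f := fun i j => f j i)]
  refine smul_right_injective M (two_ne_zero : (2 : ℂ) ≠ 0) ?_
  simp only [hdouble, hsymm]

/-! ### Lindblad terms of matrix units -/

/-- The bilinear expression in `gellMannForm`. -/
noncomputable def lindbladTerm {N : ℕ} (ρ X Y : Mat N) : Mat N := ⁅X, ρ * Y⁆ + ⁅X * ρ, Y⁆

theorem lindbladTerm_eq {N : ℕ} (ρ X Y : Mat N) :
    lindbladTerm ρ X Y = (2 : ℂ) • (X * ρ * Y) - ρ * (Y * X) - Y * X * ρ := by
  simp only [lindbladTerm, Ring.lie_def, Matrix.mul_assoc]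
  module

theorem lindbladTerm_pair {N : ℕ} (ρ : Mat N) {C : Matrix (GMIndex N) (GMIndex N) ℂ}
    (hC : IsPairPositive C) {i j : Fin N} (h : i < j) :
    (cSelf C i j • lindbladTerm ρ (lamOff i j) (lamOff i j) +
        cPair C i j • lindbladTerm ρ (lamOff i j) (lamOff j i)) +
      (cSelf C j i • lindbladTerm ρ (lamOff j i) (lamOff j i) +
        cPair C j i • lindbladTerm ρ (lamOff j i) (lamOff i j)) =
    ((gamma C i j : ℂ) • lindbladTerm ρ (Matrix.single i j 1) (Matrix.single j i 1) +
        kappa C i j • lindbladTerm ρ (Matrix.single i j 1) (Matrix.single i j 1)) +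
      ((gamma C j i : ℂ) • lindbladTerm ρ (Matrix.single j i 1) (Matrix.single i j 1) +
        kappa C j i • lindbladTerm ρ (Matrix.single j i 1) (Matrix.single j i 1)) := by
  have hpair : cPair C i j = aOff C i j + bOff C i j * Complex.I := (Complex.re_add_im _).symm
  have hpair' : cPair C j i = aOff C i j - bOff C i j * Complex.I := by
    rw [hC.pair i j, hpair]
    simp [sub_eq_add_neg]
  rw [hC.self, hC.self, hpair, hpair', gamma_of_lt C h, gamma_of_gt C h, kappa_of_lt C h,
    kappa_of_gt C h, lamOff_of_lt h, lamOff_of_gt h]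
  -- The identity is a change of basis in a bilinear expression: it uses only $s^2=\frac12$ and
  -- $I^2=-1$, nothing about matrix units.
  generalize (Matrix.single i j (1 : ℂ) : Mat N) = X
  generalize (Matrix.single j i (1 : ℂ) : Mat N) = Y
  push_cast
  have hs := invSqrtTwo_mul_self
  have hI := Complex.I_mul_I
  generalize Complex.I = I at *
  generalize invSqrtTwo = s at *
  have h11 : lindbladTerm ρ (s • (X + Y)) (s • (X + Y)) = (s * s) • (lindbladTerm ρ X X +
      lindbladTerm ρ X Y + lindbladTerm ρ Y X + lindbladTerm ρ Y Y) := by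
    simp only [lindbladTerm_eq, Matrix.mul_add, Matrix.add_mul, Matrix.mul_smul, Matrix.smul_mul]
    module
  have h12 : lindbladTerm ρ (s • (X + Y)) ((-I * s) • (X - Y)) = (-I * (s * s)) •
      (lindbladTerm ρ X X - lindbladTerm ρ X Y + lindbladTerm ρ Y X - lindbladTerm ρ Y Y) := by
    simp only [lindbladTerm_eq, Matrix.mul_add, Matrix.add_mul, Matrix.mul_sub, Matrix.sub_mul,
      Matrix.mul_smul, Matrix.smul_mul]
    module
  have h21 : lindbladTerm ρ ((-I * s) • (X - Y)) (s • (X + Y)) = (-I * (s * s)) •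
      (lindbladTerm ρ X X + lindbladTerm ρ X Y - lindbladTerm ρ Y X - lindbladTerm ρ Y Y) := by
    simp only [lindbladTerm_eq, Matrix.mul_add, Matrix.add_mul, Matrix.mul_sub, Matrix.sub_mul,
      Matrix.mul_smul, Matrix.smul_mul]
    module
  have h22 : lindbladTerm ρ ((-I * s) • (X - Y)) ((-I * s) • (X - Y)) = ((I * I) * (s * s)) •
      (lindbladTerm ρ X X - lindbladTerm ρ X Y - lindbladTerm ρ Y X + lindbladTerm ρ Y Y) := by
    simp only [lindbladTerm_eq, Matrix.mul_sub, Matrix.sub_mul, Matrix.mul_smul, Matrix.smul_mul]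
    module
  rw [h11, h12, h21, h22, hs, hI]
  match_scalars
  · ring
  · linear_combination (bOff C i j : ℂ) * hI
  · linear_combination (-(bOff C i j : ℂ)) * hI
  · ring

theorem lindbladTerm_single_swap_apply {N : ℕ} (ρ : Mat N) (i j m n : Fin N) :
    lindbladTerm ρ (Matrix.single i j 1) (Matrix.single j i 1) m n =
      (if m = i then if n = i then 2 * ρ j j else 0 else 0) - (if n = j then ρ m j else 0) -
        (if m = j then ρ j n else 0) := by
  rw [lindbladTerm_eq, Matrix.sub_apply, Matrix.sub_apply, Matrix.smul_apply,
    Matrix.single_mul_single_same, Matrix.single_mul_mul_single, smul_eq_mul, one_mul, mul_one]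
  congr 1
  · congr 1
    · rw [Matrix.single_apply]
      simp only [eq_comm (a := i)]
      split_ifs <;> simp_all
    · split_ifs with h
      · rw [h, one_mul, Matrix.mul_single_apply_same, mul_one]
      · rw [Matrix.mul_single_apply_of_ne _ _ _ _ _ h]
  · split_ifs with h
    · rw [h, one_mul, Matrix.single_mul_apply_same, one_mul]
    · rw [Matrix.single_mul_apply_of_ne _ _ _ _ _ h]

theorem lindbladTerm_single_self_apply {N : ℕ} (ρ : Mat N) {i j : Fin N} (hij : i ≠ j)
    (m n : Fin N) :
    lindbladTerm ρ (Matrix.single i j 1) (Matrix.single i j 1) m n =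
      if m = i then if n = j then 2 * ρ j i else 0 else 0 := by
  rw [lindbladTerm_eq, Matrix.single_mul_single_of_ne _ _ _ _ hij.symm, Matrix.mul_zero,
    Matrix.zero_mul, sub_zero, sub_zero, Matrix.smul_apply, Matrix.single_mul_mul_single,
    smul_eq_mul, one_mul, mul_one, Matrix.single_apply]
  simp only [eq_comm (a := i), eq_comm (a := j)]
  split_ifs <;> simp_all

theorem lindbladTerm_lamDiag_apply {N : ℕ} (ρ : Mat N) (n : Fin (N - 1)) (i j : Fin N) :
    lindbladTerm ρ (lamDiag n) (lamDiag n) i j =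
      -((diagEntry n i - diagEntry n j : ℝ) : ℂ) ^ 2 * ρ i j := by
  rw [lindbladTerm_eq, lamDiag_eq_diagonal, Matrix.diagonal_mul_diagonal, Matrix.sub_apply,
    Matrix.sub_apply, Matrix.smul_apply, Matrix.mul_diagonal, Matrix.mul_diagonal,
    Matrix.diagonal_mul, Matrix.diagonal_mul, smul_eq_mul]
  push_cast
  ring

/-- The entries of `L ρ`. -/
theorem gellMannForm_apply {N : ℕ} {C : Matrix (GMIndex N) (GMIndex N) ℂ} (h : Fin N → ℝ)
    (hC : IsPairPositive C) (hOD : C.toBlocks₁₂ = 0) (hDO : C.toBlocks₂₁ = 0)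
    (hO : IsPairBlockDiagonal C.toBlocks₁₁) (hD : C.toBlocks₂₂.IsDiag) (ρ : Mat N) (m n : Fin N) :
    gellMannForm (Matrix.diagonal fun n => (h n : ℂ)) C ρ m n =
      (-Complex.I * (h m - h n) - (outRate C m + outRate C n) / 2 - dephasing C m n) * ρ m n +
        kappa C m n * ρ n m + if m = n then ∑ j, gamma C m j * ρ j j else 0 := by
  have hsum : ∑ p, ∑ q, C p q • (⁅lam p, ρ * lam q⁆ + ⁅lam p * ρ, lam q⁆) =
      ∑ i : Fin N, ∑ j : Fin N,
        ((gamma C i j : ℂ) • lindbladTerm ρ (Matrix.single i j 1) (Matrix.single j i 1) +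
          kappa C i j • lindbladTerm ρ (Matrix.single i j 1) (Matrix.single i j 1)) +
      ∑ n, C (Sum.inr n) (Sum.inr n) • lindbladTerm ρ (lamDiag n) (lamDiag n) := by
    refine (sum_coeff_smul hOD hDO hO hD (lindbladTerm ρ)).trans ?_
    congr 1
    refine sum_sum_eq_of_symm (fun i => ?_) fun i j hij => lindbladTerm_pair ρ hC hij
    rw [gamma_self, kappa_self]
    simp [cSelf, cPair]
  have hself : ∀ i j : Fin N,
      kappa C i j * lindbladTerm ρ (Matrix.single i j 1) (Matrix.single i j 1) m n =
        if m = i then if n = j then 2 * (kappa C i j * ρ j i) else 0 else 0 := by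
    intro i j
    by_cases hij : i = j
    · rw [hij, kappa_self]
      simp
    · rw [lindbladTerm_single_self_apply ρ hij]
      split_ifs <;> ring
  have hdiag : ∀ k, (C (Sum.inr k) (Sum.inr k)) = ((C (Sum.inr k) (Sum.inr k)).re : ℂ) :=
    fun k => Complex.ext rfl (Complex.nonneg_iff.1 (hC.diag k)).2.symm
  have hdeph : ∑ k, C (Sum.inr k) (Sum.inr k) *
      (-((diagEntry k m - diagEntry k n : ℝ) : ℂ) ^ 2 * ρ m n) =
        -2 * (dephasing C m n : ℂ) * ρ m n := by
    rw [dephasing]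
    push_cast
    rw [mul_div_assoc', neg_mul, neg_div, mul_div_cancel_left₀ _ (two_ne_zero' ℂ), neg_mul,
      Finset.sum_mul, ← Finset.sum_neg_distrib]
    refine Finset.sum_congr rfl fun k _ => ?_
    rw [← hdiag]
    ring
  have hgamma : ∑ i : Fin N, ∑ j : Fin N, (gamma C i j : ℂ) *
      ((if m = i then if n = i then 2 * ρ j j else 0 else 0) - (if n = j then ρ m j else 0) -
        (if m = j then ρ j n else 0)) =
      2 * (if m = n then ∑ j, gamma C m j * ρ j j else 0) - outRate C n * ρ m n -
        outRate C m * ρ m n := by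
    simp only [mul_sub, Finset.sum_sub_distrib, mul_ite, mul_zero, Finset.sum_ite_eq,
      Finset.mem_univ, if_true]
    rw [← Finset.sum_mul, ← Finset.sum_mul, outRate, outRate]
    push_cast
    congr 2
    rw [Finset.sum_eq_single m]
    · simp only [if_true, eq_comm (a := n)]
      split_ifs
      · rw [Finset.mul_sum]
        exact Finset.sum_congr rfl fun j _ => by ring
      · exact Finset.sum_const_zero
    · intro i _ hi
      simp [hi.symm]
    · exact fun h => absurd (Finset.mem_univ m) h
  have hentry := congrFun (congrFun hsum m) n
  rw [gellMannForm, Matrix.add_apply, Matrix.smul_apply, hentry]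
  simp only [Matrix.add_apply, Matrix.sum_apply, Matrix.smul_apply, Matrix.neg_apply,
    smul_eq_mul, Ring.lie_def, Matrix.sub_apply, Matrix.diagonal_mul, Matrix.mul_diagonal,
    lindbladTerm_single_swap_apply, hself, lindbladTerm_lamDiag_apply, Finset.sum_add_distrib,
    hdeph, hgamma, Finset.sum_ite_eq, Finset.sum_ite_irrel, Finset.sum_const_zero, Finset.mem_univ,
    if_true]
  ring

end QDS

namespace QDS

/-! ### Weights of the digraph -/

theorem IsPairPositive.sq_add_sq_le {N : ℕ} {C : Matrix (GMIndex N) (GMIndex N) ℂ}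
    (hC : IsPairPositive C) (k l : Fin N) :
    aOff C k l ^ 2 + bOff C k l ^ 2 ≤ cOff C k l * cOff C l k := by
  have h := hC.det k l
  rw [Complex.normSq_apply] at h
  simpa only [sq, aOff, bOff] using h

/-- By the arithmetic-geometric mean inequality, $b^2\le c_{ij}c_{ji}\le((c_{ij}+c_{ji})/2)^2$. -/
theorem IsPairPositive.gamma_nonneg {N : ℕ} {C : Matrix (GMIndex N) (GMIndex N) ℂ}
    (hC : IsPairPositive C) (i j : Fin N) : 0 ≤ gamma C i j := by
  have key : ∀ i j : Fin N, |2 * bOff C i j| ≤ cOff C i j + cOff C j i := fun i j => by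
    refine abs_le_of_sq_le_sq ?_ (add_nonneg (hC.nonneg i j) (hC.nonneg j i))
    nlinarith [hC.sq_add_sq_le i j, sq_nonneg (cOff C i j - cOff C j i), sq_nonneg (aOff C i j)]
  rcases lt_trichotomy i j with h | rfl | h
  · rw [gamma_of_lt C h]
    linarith [(abs_le.1 (key i j)).2]
  · rw [gamma_self]
  · rw [gamma_of_gt C h]
    linarith [(abs_le.1 (key j i)).1]

theorem gamma_add_gamma {N : ℕ} (C : Matrix (GMIndex N) (GMIndex N) ℂ) {k l : Fin N} (h : k < l) :
    gamma C k l + gamma C l k = cOff C k l + cOff C l k := by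
  rw [gamma_of_lt C h, gamma_of_gt C h]
  ring

theorem IsPairPositive.gamma_le_outRate {N : ℕ} {C : Matrix (GMIndex N) (GMIndex N) ℂ}
    (hC : IsPairPositive C) (k l : Fin N) : gamma C l k ≤ outRate C k :=
  Finset.single_le_sum (f := fun j => gamma C j k) (fun j _ => hC.gamma_nonneg j k)
    (Finset.mem_univ l)

theorem IsPairPositive.outRate_eq_iff {N : ℕ} {C : Matrix (GMIndex N) (GMIndex N) ℂ}
    (hC : IsPairPositive C) (k l : Fin N) :
    outRate C k = gamma C l k ↔ ∀ j, j ≠ k → j ≠ l → ¬ HasEdge (gamma C) k j := by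
  rw [outRate, ← Finset.add_sum_erase _ _ (Finset.mem_univ l), add_eq_left,
    Finset.sum_eq_zero_iff_of_nonneg fun j _ => hC.gamma_nonneg j k]
  constructor
  · intro h j _ hjl he
    exact he.2.ne' (h j (Finset.mem_erase.2 ⟨hjl, Finset.mem_univ j⟩))
  · intro h j hj
    by_cases hjk : j = k
    · rw [hjk, gamma_self]
    · by_contra hne
      exact h j hjk (Finset.ne_of_mem_erase hj)
        ⟨Ne.symm hjk, (hC.gamma_nonneg j k).lt_of_ne' hne⟩

theorem IsPairPositive.gamma_eq_zero_of_isSink {N : ℕ} {C : Matrix (GMIndex N) (GMIndex N) ℂ}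
    (hC : IsPairPositive C) {k : Fin N} (hk : IsSink (gamma C) k) (j : Fin N) :
    gamma C j k = 0 := by
  by_cases hjk : j = k
  · rw [hjk, gamma_self]
  · by_contra hne
    exact hk j ⟨Ne.symm hjk, (hC.gamma_nonneg j k).lt_of_ne' hne⟩

theorem dephasing_comm {N : ℕ} (C : Matrix (GMIndex N) (GMIndex N) ℂ) (k l : Fin N) :
    dephasing C l k = dephasing C k l := by
  simp only [dephasing, sub_sq_comm]

theorem IsPairPositive.dephasing_nonneg {N : ℕ} {C : Matrix (GMIndex N) (GMIndex N) ℂ}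
    (hC : IsPairPositive C) (k l : Fin N) : 0 ≤ dephasing C k l :=
  div_nonneg (Finset.sum_nonneg fun n _ =>
    mul_nonneg (Complex.nonneg_iff.1 (hC.diag n)).1 (sq_nonneg _)) zero_le_two

theorem IsPairPositive.dephasing_eq_zero_iff {N : ℕ} {C : Matrix (GMIndex N) (GMIndex N) ℂ}
    (hC : IsPairPositive C) {k l : Fin N} (h : k < l) :
    dephasing C k l = 0 ↔ DiagVanishes C k l := by
  rw [dephasing, div_eq_zero_iff, or_iff_left (two_ne_zero' ℝ),
    Finset.sum_eq_zero_iff_of_nonneg fun n _ =>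
      mul_nonneg (Complex.nonneg_iff.1 (hC.diag n)).1 (sq_nonneg _)]
  simp only [Finset.mem_univ, true_imp_iff, mul_eq_zero, sq_eq_zero_iff, sub_eq_zero,
    diagEntry_eq_iff h, DiagVanishes]
  refine forall_congr' fun n => ?_
  have : (C (Sum.inr n) (Sum.inr n)).re = 0 ↔ C (Sum.inr n) (Sum.inr n) = 0 :=
    ⟨fun hn => Complex.ext hn (Complex.nonneg_iff.1 (hC.diag n)).2.symm, fun hn => by simp [hn]⟩
  rw [this]
  tauto

/-! ### The blocks -/

/-- Decay rate of the coherence between `k` and `l`. -/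
noncomputable def decay {N : ℕ} (C : Matrix (GMIndex N) (GMIndex N) ℂ) (k l : Fin N) : ℝ :=
  (outRate C k + outRate C l) / 2 + dephasing C k l

/-- The action of a superoperator on matrix entries in the shape of `gellMannForm_apply`. -/
def HasEntryFormula {N : ℕ} (L : Mat N →ₗ[ℂ] Mat N) (h : Fin N → ℝ)
    (C : Matrix (GMIndex N) (GMIndex N) ℂ) : Prop :=
  ∀ ρ m n, L ρ m n =
    (-Complex.I * (h m - h n) - (outRate C m + outRate C n) / 2 - dephasing C m n) * ρ m n +
      kappa C m n * ρ n m + if m = n then ∑ j, gamma C m j * ρ j j else 0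

theorem HasEntryFormula.apply_pairComb {N : ℕ} {L : Mat N →ₗ[ℂ] Mat N} {h : Fin N → ℝ}
    {C : Matrix (GMIndex N) (GMIndex N) ℂ} (hL : HasEntryFormula L h C) {k l : Fin N}
    (hkl : k < l) (x y : ℂ) :
    L (pairComb k l x y) = pairComb k l
      ((-decay C k l + (cOff C k l - cOff C l k) / 2 : ℝ) * x + (aOff C k l - (h k - h l) : ℝ) * y)
      ((aOff C k l + (h k - h l) : ℝ) * x +
        (-decay C k l - (cOff C k l - cOff C l k) / 2 : ℝ) * y) := by
  have hdiag : ∀ i, pairComb k l x y i i = 0 := fun i =>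
    pairComb_apply_of_ne hkl x y (fun h => hkl.ne (h.1.symm.trans h.2))
      fun h => hkl.ne (h.2.symm.trans h.1)
  have hI := Complex.I_mul_I
  ext m n
  rw [hL]
  simp only [hdiag, mul_zero, Finset.sum_const_zero, ite_self, add_zero]
  by_cases h1 : m = k ∧ n = l
  · obtain ⟨rfl, rfl⟩ := h1
    rw [pairComb_apply_left hkl, pairComb_apply_left hkl, pairComb_apply_right hkl,
      kappa_of_lt C hkl, decay]
    push_cast
    generalize invSqrtTwo = s
    linear_combination (s * y * (h m - h n) - s * y * aOff C m n) * hI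
  · by_cases h2 : m = l ∧ n = k
    · obtain ⟨rfl, rfl⟩ := h2
      rw [pairComb_apply_right hkl, pairComb_apply_left hkl, pairComb_apply_right hkl,
        kappa_of_gt C hkl, decay, dephasing_comm]
      push_cast
      generalize invSqrtTwo = s
      linear_combination (s * y * (h n - h m) - s * y * aOff C n m) * hI
    · rw [pairComb_apply_of_ne hkl _ _ h1 h2, pairComb_apply_of_ne hkl _ _ h1 h2,
        pairComb_apply_of_ne hkl _ _ (fun h => h2 h.symm) (fun h => h1 h.symm), mul_zero, mul_zero,
        add_zero]

theorem pairComb_one_zero {N : ℕ} (k l : Fin N) : pairComb k l 1 0 = lamOff k l := by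
  simp [pairComb]

theorem pairComb_zero_one {N : ℕ} (k l : Fin N) : pairComb k l 0 1 = lamOff l k := by
  simp [pairComb]

theorem pairComb_eq_zero {N : ℕ} {k l : Fin N} (hkl : k < l) {x y : ℂ}
    (h : pairComb k l x y = 0) : x = 0 ∧ y = 0 := by
  constructor
  · rw [← trace_lamOff_mul_pairComb_left hkl x y, h, Matrix.mul_zero, Matrix.trace_zero]
  · rw [← trace_lamOff_mul_pairComb_right hkl x y, h, Matrix.mul_zero, Matrix.trace_zero]

theorem HasEntryFormula.pairBlock_eq {N : ℕ} {L : Mat N →ₗ[ℂ] Mat N} {h : Fin N → ℝ}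
    {C : Matrix (GMIndex N) (GMIndex N) ℂ} (hL : HasEntryFormula L h C) {k l : Fin N}
    (hkl : k < l) :
    pairBlock L k l =
      !![((-decay C k l + (cOff C k l - cOff C l k) / 2 : ℝ) : ℂ), (aOff C k l - (h k - h l) : ℝ);
        (aOff C k l + (h k - h l) : ℝ), (-decay C k l - (cOff C k l - cOff C l k) / 2 : ℝ)] := by
  have h1 := hL.apply_pairComb hkl 1 0
  have h2 := hL.apply_pairComb hkl 0 1
  rw [pairComb_one_zero] at h1
  rw [pairComb_zero_one] at h2
  simp only [mul_zero, mul_one, add_zero, zero_add] at h1 h2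
  ext r s
  fin_cases r <;> fin_cases s <;>
    simp only [pairBlock, lamPair, Matrix.of_apply, Fin.zero_eta, Fin.mk_one, Matrix.cons_val_zero,
      Matrix.cons_val_one, lamOff_isHermitian, h1, h2, trace_lamOff_mul_pairComb_left hkl,
      trace_lamOff_mul_pairComb_right hkl]

/-- The grouping matters: under `IsPairPositive` each of the three summands is nonnegative. -/
theorem HasEntryFormula.det_pairBlock {N : ℕ} {L : Mat N →ₗ[ℂ] Mat N} {h : Fin N → ℝ}
    {C : Matrix (GMIndex N) (GMIndex N) ℂ} (hL : HasEntryFormula L h C) {k l : Fin N}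
    (hkl : k < l) :
    (pairBlock L k l).det = (((h k - h l) ^ 2 +
      (decay C k l ^ 2 - ((cOff C k l + cOff C l k) / 2) ^ 2) +
      (cOff C k l * cOff C l k - aOff C k l ^ 2) : ℝ) : ℂ) := by
  rw [hL.pairBlock_eq hkl, Matrix.det_fin_two_of]
  push_cast
  ring

theorem HasEntryFormula.mem_kerPairBlock {N : ℕ} {L : Mat N →ₗ[ℂ] Mat N} {h : Fin N → ℝ}
    {C : Matrix (GMIndex N) (GMIndex N) ℂ} (hL : HasEntryFormula L h C) {k l : Fin N}
    (hkl : k < l) {A : Mat N} :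
    A ∈ kerPairBlock L k l ↔ ∃ x y : ℂ,
      ((-decay C k l + (cOff C k l - cOff C l k) / 2 : ℝ) * x +
        (aOff C k l - (h k - h l) : ℝ) * y = 0 ∧
      (aOff C k l + (h k - h l) : ℝ) * x +
        (-decay C k l - (cOff C k l - cOff C l k) / 2 : ℝ) * y = 0) ∧ pairComb k l x y = A := by
  rw [kerPairBlock, Submodule.mem_map]
  simp only [LinearMap.mem_ker, Matrix.toLin'_apply, hL.pairBlock_eq hkl, funext_iff,
    Fin.forall_fin_two, Matrix.mulVec, dotProduct, Fin.sum_univ_two, Matrix.of_apply,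
    Matrix.cons_val_zero, Matrix.cons_val_one, Pi.zero_apply, Fintype.linearCombination_apply,
    lamPair]
  constructor
  · rintro ⟨v, hv, rfl⟩
    exact ⟨v 0, v 1, hv, rfl⟩
  · rintro ⟨x, y, hv, rfl⟩
    exact ⟨![x, y], hv, rfl⟩

theorem HasEntryFormula.pairComb_mem_ker_iff {N : ℕ} {L : Mat N →ₗ[ℂ] Mat N} {h : Fin N → ℝ}
    {C : Matrix (GMIndex N) (GMIndex N) ℂ} (hL : HasEntryFormula L h C) {k l : Fin N}
    (hkl : k < l) {x y : ℂ} :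
    pairComb k l x y ∈ LinearMap.ker L ↔ pairComb k l x y ∈ kerPairBlock L k l := by
  rw [hL.mem_kerPairBlock hkl, LinearMap.mem_ker, hL.apply_pairComb hkl]
  constructor
  · intro h0
    exact ⟨x, y, pairComb_eq_zero hkl h0, rfl⟩
  · rintro ⟨x', y', ⟨h1, h2⟩, hxy⟩
    have hx : x' = x := by
      rw [← trace_lamOff_mul_pairComb_left hkl x y, ← hxy, trace_lamOff_mul_pairComb_left hkl]
    have hy : y' = y := by
      rw [← trace_lamOff_mul_pairComb_right hkl x y, ← hxy, trace_lamOff_mul_pairComb_right hkl]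
    subst hx hy
    rw [h1, h2]
    simp [pairComb]

/-! ### Singular blocks -/

/-- The two out-rates include the mutual edges, whose weights add up to $c_{k\ell}+c_{\ell k}$.
Equality means no other edge leaves the pair and there is no dephasing. -/
theorem IsPairPositive.le_decay {N : ℕ} {C : Matrix (GMIndex N) (GMIndex N) ℂ}
    (hC : IsPairPositive C) {k l : Fin N} (hkl : k < l) :
    (cOff C k l + cOff C l k) / 2 ≤ decay C k l := by
  rw [decay, ← gamma_add_gamma C hkl]
  linarith [hC.gamma_le_outRate k l, hC.gamma_le_outRate l k, hC.dephasing_nonneg k l]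

theorem IsPairPositive.decay_eq_iff {N : ℕ} {C : Matrix (GMIndex N) (GMIndex N) ℂ}
    (hC : IsPairPositive C) {k l : Fin N} (hkl : k < l) :
    decay C k l = (cOff C k l + cOff C l k) / 2 ↔ DiagVanishes C k l ∧
      ∀ j, j ≠ k → j ≠ l → ¬ HasEdge (gamma C) k j ∧ ¬ HasEdge (gamma C) l j := by
  have h1 := hC.outRate_eq_iff k l
  have h2 := hC.outRate_eq_iff l k
  have h3 := hC.gamma_le_outRate k l
  have h4 := hC.gamma_le_outRate l k
  have h5 := hC.dephasing_nonneg k l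
  rw [← hC.dephasing_eq_zero_iff hkl, decay, ← gamma_add_gamma C hkl]
  constructor
  · intro h
    have h1' := h1.1 (by linarith)
    have h2' := h2.1 (by linarith)
    exact ⟨by linarith, fun j hk hl => ⟨h1' j hk hl, h2' j hl hk⟩⟩
  · rintro ⟨hd, he⟩
    rw [h1.2 fun j hk hl => (he j hk hl).1, h2.2 fun j hl hk => (he j hk hl).2, hd]
    ring

theorem HasEntryFormula.det_eq_zero_iff {N : ℕ} {L : Mat N →ₗ[ℂ] Mat N} {h : Fin N → ℝ}
    {C : Matrix (GMIndex N) (GMIndex N) ℂ} (hL : HasEntryFormula L h C) (hC : IsPairPositive C)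
    {k l : Fin N} (hkl : k < l) :
    (pairBlock L k l).det = 0 ↔ h k = h l ∧ decay C k l = (cOff C k l + cOff C l k) / 2 ∧
      cOff C k l * cOff C l k = aOff C k l ^ 2 := by
  rw [hL.det_pairBlock hkl, Complex.ofReal_eq_zero]
  have h1 := hC.le_decay hkl
  have h2 := hC.sq_add_sq_le k l
  have h3 := hC.nonneg k l
  have h4 := hC.nonneg l k
  have h5 : ((cOff C k l + cOff C l k) / 2) ^ 2 ≤ decay C k l ^ 2 :=
    pow_le_pow_left₀ (by linarith) h1 2
  constructor
  · intro h0
    have h6 := sq_nonneg (h k - h l)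
    have h7 := sq_nonneg (bOff C k l)
    refine ⟨sub_eq_zero.1 (pow_eq_zero_iff two_ne_zero |>.1 (by linarith : (h k - h l) ^ 2 = 0)),
      ?_, by linarith⟩
    exact (pow_left_inj₀ (by linarith) (by linarith) two_ne_zero).1
      (by linarith : decay C k l ^ 2 = ((cOff C k l + cOff C l k) / 2) ^ 2)
  · rintro ⟨h6, h7, h8⟩
    rw [h6, h7, h8]
    ring

theorem HasEntryFormula.singular_iff {N : ℕ} {L : Mat N →ₗ[ℂ] Mat N} {h : Fin N → ℝ}
    {C : Matrix (GMIndex N) (GMIndex N) ℂ} (hL : HasEntryFormula L h C) (hC : IsPairPositive C)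
    {k l : Fin N} (hkl : k < l) :
    (pairBlock L k l).det = 0 ↔ h k = h l ∧ DiagVanishes C k l ∧
      ((IsSink (gamma C) k ∧ IsSink (gamma C) l) ∨ IsSingularTwoSink C k l) := by
  rw [hL.det_eq_zero_iff hC hkl, hC.decay_eq_iff hkl, and_assoc]
  refine and_congr_right fun _ => and_congr_right fun _ => ?_
  have hsq := hC.sq_add_sq_le k l
  have h3 := hC.nonneg k l
  have h4 := hC.nonneg l k
  have hg1 := gamma_of_lt C hkl
  have hg2 := gamma_of_gt C hkl
  constructor
  · rintro ⟨he, hdet⟩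
    -- From $a^2+b^2\le c_{k\ell}c_{\ell k}=a^2$. Both mutual edges then have weight
    -- $(c_{k\ell}+c_{\ell k})/2$: if it is zero both vertices are sinks, otherwise the pair is a
    -- 2-sink.
    have hb : bOff C k l = 0 := by
      have := sq_nonneg (bOff C k l)
      exact pow_eq_zero_iff two_ne_zero |>.1 (by linarith)
    rw [hb] at hg1 hg2
    rcases (add_nonneg h3 h4).eq_or_lt with hs | hs
    · refine Or.inl ⟨fun j hj => ?_, fun j hj => ?_⟩
      · by_cases hjl : j = l
        · have := hj.2
          rw [hjl] at this
          linarith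
        · exact (he j hj.1.symm hjl).1 hj
      · by_cases hjk : j = k
        · have := hj.2
          rw [hjk] at this
          linarith
        · exact (he j hjk hj.1.symm).2 hj
    · exact Or.inr ⟨⟨⟨hkl.ne, by linarith⟩, ⟨hkl.ne', by linarith⟩, he⟩, sub_eq_zero.2 hdet⟩
  · rintro (⟨hk, hl⟩ | ⟨⟨_, _, he⟩, hdet⟩)
    · refine ⟨fun j _ _ => ⟨hk j, hl j⟩, ?_⟩
      rw [hC.gamma_eq_zero_of_isSink hl] at hg1
      rw [hC.gamma_eq_zero_of_isSink hk] at hg2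
      have hc1 : cOff C k l = 0 := by linarith
      have := sq_nonneg (aOff C k l)
      have := sq_nonneg (bOff C k l)
      rw [hc1, zero_mul] at hsq ⊢
      linarith
    · exact ⟨he, sub_eq_zero.1 hdet⟩

/-- A singular block has equal energies and minimal decay, so it reduces to $\begin{pmatrix}-c_{\ell
k}&a\\a&-c_{k\ell}\end{pmatrix}$. -/
theorem HasEntryFormula.mem_kerPairBlock_of_singular {N : ℕ} {L : Mat N →ₗ[ℂ] Mat N}
    {h : Fin N → ℝ} {C : Matrix (GMIndex N) (GMIndex N) ℂ} (hL : HasEntryFormula L h C)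
    (hC : IsPairPositive C) {k l : Fin N} (hkl : k < l) (hdet : (pairBlock L k l).det = 0)
    {A : Mat N} :
    A ∈ kerPairBlock L k l ↔ ∃ x y : ℂ, ((cOff C l k : ℂ) * x = aOff C k l * y ∧
      (aOff C k l : ℂ) * x = cOff C k l * y) ∧ pairComb k l x y = A := by
  obtain ⟨h1, h2, -⟩ := (hL.det_eq_zero_iff hC hkl).1 hdet
  rw [hL.mem_kerPairBlock hkl, h1, h2]
  refine exists_congr fun x => exists_congr fun y => and_congr_left fun _ => and_congr ?_ ?_
  · rw [← sub_eq_zero (b := (aOff C k l : ℂ) * y), ← neg_eq_zero]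
    push_cast
    ring_nf
  · rw [← sub_eq_zero (b := (cOff C k l : ℂ) * y)]
    push_cast
    ring_nf

theorem HasEntryFormula.kerPairBlock_of_isSink {N : ℕ} {L : Mat N →ₗ[ℂ] Mat N}
    {h : Fin N → ℝ} {C : Matrix (GMIndex N) (GMIndex N) ℂ} (hL : HasEntryFormula L h C)
    (hC : IsPairPositive C) {k l : Fin N} (hkl : k < l) (hdet : (pairBlock L k l).det = 0)
    (hk : IsSink (gamma C) k) (hl : IsSink (gamma C) l) :
    kerPairBlock L k l = Submodule.span ℂ {lamOff k l, lamOff l k} := by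
  have h3 := hC.nonneg k l
  have h4 := hC.nonneg l k
  have hg := gamma_add_gamma C hkl
  rw [hC.gamma_eq_zero_of_isSink hk, hC.gamma_eq_zero_of_isSink hl] at hg
  have hc1 : cOff C k l = 0 := by linarith
  have hc2 : cOff C l k = 0 := by linarith
  have ha : aOff C k l = 0 := by
    have := ((hL.det_eq_zero_iff hC hkl).1 hdet).2.2
    rw [hc1, zero_mul] at this
    exact pow_eq_zero_iff two_ne_zero |>.1 this.symm
  ext A
  rw [hL.mem_kerPairBlock_of_singular hC hkl hdet, Submodule.mem_span_pair, hc1, hc2, ha]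
  simp [pairComb]

theorem HasEntryFormula.kerPairBlock_of_singular {N : ℕ} {L : Mat N →ₗ[ℂ] Mat N}
    {h : Fin N → ℝ} {C : Matrix (GMIndex N) (GMIndex N) ℂ} (hL : HasEntryFormula L h C)
    (hC : IsPairPositive C) {k l : Fin N} (hkl : k < l) (hdet : (pairBlock L k l).det = 0)
    (hne : ¬ (cOff C k l = -aOff C k l ∧ cOff C l k = -aOff C k l)) :
    kerPairBlock L k l = Submodule.span ℂ
      {((cOff C k l + aOff C k l : ℝ) : ℂ) • lamOff k l +
        ((cOff C l k + aOff C k l : ℝ) : ℂ) • lamOff l k} := by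
  have hdet' : (cOff C k l : ℂ) * cOff C l k = aOff C k l ^ 2 := by
    exact_mod_cast ((hL.det_eq_zero_iff hC hkl).1 hdet).2.2
  have hne' : ¬ ((cOff C k l : ℂ) + aOff C k l = 0 ∧ (cOff C l k : ℂ) + aOff C k l = 0) := by
    rintro ⟨h1, h2⟩
    exact hne ⟨eq_neg_of_add_eq_zero_left (by exact_mod_cast h1),
      eq_neg_of_add_eq_zero_left (by exact_mod_cast h2)⟩
  ext A
  rw [hL.mem_kerPairBlock_of_singular hC hkl hdet, Submodule.mem_span_singleton]
  push_cast
  constructor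
  · rintro ⟨x, y, ⟨h1, h2⟩, rfl⟩
    -- Adding the two equations makes $(x,y)$ proportional to $(c_{k\ell}+a,c_{\ell k}+a)$, which is
    -- nonzero by `hne'`.
    have hxy : x * ((cOff C l k : ℂ) + aOff C k l) = y * ((cOff C k l : ℂ) + aOff C k l) := by
      linear_combination h1 + h2
    suffices ∃ t : ℂ, t * ((cOff C k l : ℂ) + aOff C k l) = x ∧
        t * ((cOff C l k : ℂ) + aOff C k l) = y by
      obtain ⟨t, rfl, rfl⟩ := this
      exact ⟨t, by rw [smul_add, smul_smul, smul_smul, pairComb]⟩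
    by_cases hz : (cOff C k l : ℂ) + aOff C k l = 0
    · have hz' : (cOff C l k : ℂ) + aOff C k l ≠ 0 := fun hz' => hne' ⟨hz, hz'⟩
      rw [hz, mul_zero, mul_eq_zero, or_iff_left hz'] at hxy
      exact ⟨y / ((cOff C l k : ℂ) + aOff C k l), by rw [hz, hxy, mul_zero],
        div_mul_cancel₀ _ hz'⟩
    · exact ⟨x / ((cOff C k l : ℂ) + aOff C k l), div_mul_cancel₀ _ hz, by
        rw [div_mul_eq_mul_div, hxy, mul_div_cancel_right₀ _ hz]⟩
  · rintro ⟨t, rfl⟩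
    refine ⟨t * ((cOff C k l : ℂ) + aOff C k l), t * ((cOff C l k : ℂ) + aOff C k l), ⟨?_, ?_⟩, ?_⟩
    · linear_combination t * hdet'
    · linear_combination -t * hdet'
    · rw [smul_add, smul_smul, smul_smul, pairComb]

theorem HasEntryFormula.kerPairBlock_of_antidiagonal {N : ℕ} {L : Mat N →ₗ[ℂ] Mat N}
    {h : Fin N → ℝ} {C : Matrix (GMIndex N) (GMIndex N) ℂ} (hL : HasEntryFormula L h C)
    (hC : IsPairPositive C) {k l : Fin N} (hkl : k < l) (hdet : (pairBlock L k l).det = 0)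
    (hS : IsTwoSink (gamma C) k l) (h1 : cOff C k l = -aOff C k l)
    (h2 : cOff C l k = -aOff C k l) :
    kerPairBlock L k l = Submodule.span ℂ {lamOff k l - lamOff l k} := by
  -- If $a=0$ then $c_{k\ell}=c_{\ell k}=0$, and the mutual edges of the 2-sink would have total
  -- weight zero.
  have ha : (aOff C k l : ℂ) ≠ 0 := by
    rw [Complex.ofReal_ne_zero]
    intro ha
    have hg := gamma_add_gamma C hkl
    rw [h1, h2, ha] at hg
    linarith [hS.1.2, hS.2.1.2]
  ext A
  rw [hL.mem_kerPairBlock_of_singular hC hkl hdet, Submodule.mem_span_singleton, h1, h2]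
  push_cast
  constructor
  · rintro ⟨x, y, ⟨-, h4⟩, rfl⟩
    have hy : y = -x := mul_left_cancel₀ ha (by linear_combination h4)
    exact ⟨x, by rw [hy, pairComb, smul_sub, neg_smul, sub_eq_add_neg]⟩
  · rintro ⟨t, rfl⟩
    exact ⟨t, -t, ⟨by ring, by ring⟩, by rw [pairComb, smul_sub, neg_smul, sub_eq_add_neg]⟩

/-! ### The kernel as a direct sum -/

/-- The pair of indices, or the diagonal (`none`), to which the entry at `(i, j)` belongs. -/
def entryClass {N : ℕ} (i j : Fin N) : Option {p : Fin N × Fin N // p.1 < p.2} :=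
  if h : i < j then some ⟨(i, j), h⟩ else if h : j < i then some ⟨(j, i), h⟩ else none

theorem entryClass_comm {N : ℕ} (i j : Fin N) : entryClass i j = entryClass j i := by
  unfold entryClass
  split_ifs with h1 h2
  · exact absurd h2 h1.not_gt
  · rfl
  · rfl
  · rfl

theorem entryClass_eq_none {N : ℕ} {i j : Fin N} : entryClass i j = none ↔ i = j := by
  unfold entryClass
  split_ifs with h1 h2
  · simp [h1.ne]
  · simp [h2.ne']
  · simpa using le_antisymm (not_lt.1 h2) (not_lt.1 h1)

theorem entryClass_eq_some {N : ℕ} {i j : Fin N} {p : {p : Fin N × Fin N // p.1 < p.2}} :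
    entryClass i j = some p ↔ i = p.1.1 ∧ j = p.1.2 ∨ i = p.1.2 ∧ j = p.1.1 := by
  obtain ⟨⟨k, l⟩, hkl⟩ := p
  unfold entryClass
  simp only at hkl
  split_ifs with h1 h2
  · simp only [Option.some.injEq, Subtype.mk.injEq, Prod.mk.injEq]
    refine ⟨Or.inl, ?_⟩
    rintro (h | ⟨rfl, rfl⟩)
    · exact h
    · exact absurd hkl h1.not_gt
  · simp only [Option.some.injEq, Subtype.mk.injEq, Prod.mk.injEq]
    refine ⟨fun h => Or.inr h.symm, ?_⟩
    rintro (⟨rfl, rfl⟩ | h)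
    · exact absurd hkl h1
    · exact h.symm
  · simp only [false_iff]
    rintro (⟨rfl, rfl⟩ | ⟨rfl, rfl⟩)
    · exact h1 hkl
    · exact h2 hkl

/-- The matrices whose entries vanish wherever `P` holds. -/
def vanishing {N : ℕ} (P : Fin N → Fin N → Prop) : Submodule ℂ (Mat N) where
  carrier := {A | ∀ i j, P i j → A i j = 0}
  add_mem' hA hB i j hP := by rw [Matrix.add_apply, hA i j hP, hB i j hP, add_zero]
  zero_mem' _ _ _ := rfl
  smul_mem' c A hA i j hP := by rw [Matrix.smul_apply, hA i j hP, smul_zero]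

/-- The classes partition the matrix positions, so subspaces supported on different classes are
independent. -/
theorem iSupIndep_of_entryClass {N : ℕ}
    {F : Option {p : Fin N × Fin N // p.1 < p.2} → Submodule ℂ (Mat N)}
    (hF : ∀ o, ∀ A ∈ F o, ∀ i j, entryClass i j ≠ o → A i j = 0) : iSupIndep F := by
  intro o
  rw [Submodule.disjoint_def]
  intro A hA hA'
  have hle : ⨆ o', ⨆ (_ : o' ≠ o), F o' ≤ vanishing fun i j => entryClass i j = o := by
    refine iSup₂_le fun o' ho' B hB i j hij => hF o' B hB i j ?_
    rw [hij]
    exact ho'.symm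
  ext i j
  by_cases hij : entryClass i j = o
  · exact hle hA' i j hij
  · exact hF o A hA i j hij

/-- The entries of `A` that belong to `o`. -/
def classPart {N : ℕ} (o : Option {p : Fin N × Fin N // p.1 < p.2}) (A : Mat N) : Mat N :=
  Matrix.of fun i j => if entryClass i j = o then A i j else 0

theorem classPart_apply {N : ℕ} (o : Option {p : Fin N × Fin N // p.1 < p.2}) (A : Mat N)
    (i j : Fin N) : classPart o A i j = if entryClass i j = o then A i j else 0 := rfl

theorem sum_classPart {N : ℕ} (A : Mat N) : ∑ o, classPart o A = A := by
  ext i j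
  simp [Matrix.sum_apply, classPart_apply]

theorem classPart_none {N : ℕ} (A : Mat N) :
    classPart none A = Matrix.diagonal fun i => A i i := by
  ext i j
  rw [classPart_apply, Matrix.diagonal_apply]
  simp only [entryClass_eq_none]
  split_ifs with h
  · rw [h]
  · rfl

theorem classPart_some {N : ℕ} (A : Mat N) (p : {p : Fin N × Fin N // p.1 < p.2}) :
    classPart (some p) A = pairComb p.1.1 p.1.2 (invSqrtTwo * (A p.1.1 p.1.2 + A p.1.2 p.1.1))
      (invSqrtTwo * Complex.I * (A p.1.1 p.1.2 - A p.1.2 p.1.1)) := by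
  ext i j
  have hs := invSqrtTwo_mul_self
  have hI := Complex.I_mul_I
  simp only [classPart_apply, entryClass_eq_some]
  by_cases h1 : i = p.1.1 ∧ j = p.1.2
  · rw [if_pos (Or.inl h1), h1.1, h1.2, pairComb_apply_left p.2]
    linear_combination (-2 * A p.1.1 p.1.2) * hs +
      invSqrtTwo * invSqrtTwo * (A p.1.1 p.1.2 - A p.1.2 p.1.1) * hI
  · by_cases h2 : i = p.1.2 ∧ j = p.1.1
    · rw [if_pos (Or.inr h2), h2.1, h2.2, pairComb_apply_right p.2]
      linear_combination (-2 * A p.1.2 p.1.1) * hs -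
        invSqrtTwo * invSqrtTwo * (A p.1.1 p.1.2 - A p.1.2 p.1.1) * hI
    · rw [if_neg (not_or.2 ⟨h1, h2⟩), pairComb_apply_of_ne p.2 _ _ h1 h2]

/-- Off the diagonal the entry formula couples $(m,n)$ only to $(n,m)$, and diagonal entries only to
diagonal entries. Hence every class component of a kernel element is again in the kernel. -/
theorem HasEntryFormula.apply_classPart {N : ℕ} {L : Mat N →ₗ[ℂ] Mat N} {h : Fin N → ℝ}
    {C : Matrix (GMIndex N) (GMIndex N) ℂ} (hL : HasEntryFormula L h C)
    (o : Option {p : Fin N × Fin N // p.1 < p.2}) (A : Mat N) :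
    L (classPart o A) = classPart o (L A) := by
  ext i j
  rw [classPart_apply, hL, hL, classPart_apply, classPart_apply, entryClass_comm j i]
  split_ifs with h1 h2 h2
  · congr 1
    refine Finset.sum_congr rfl fun k _ => ?_
    rw [classPart_apply, if_pos]
    rw [← h1, entryClass_eq_none.2 rfl, entryClass_eq_none.2 h2]
  · rfl
  · rw [mul_zero, mul_zero, add_zero, zero_add]
    refine Finset.sum_eq_zero fun k _ => ?_
    rw [classPart_apply, if_neg, mul_zero]
    rwa [entryClass_eq_none.2 rfl, ← entryClass_eq_none.2 h2]
  · simp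

/-- On the diagonal the Hamiltonian, dephasing and $\kappa$ terms vanish, leaving inflow minus
outflow. -/
theorem HasEntryFormula.diagonal_mem_ker_iff {N : ℕ} {L : Mat N →ₗ[ℂ] Mat N} {h : Fin N → ℝ}
    {C : Matrix (GMIndex N) (GMIndex N) ℂ} (hL : HasEntryFormula L h C) {x : Fin N → ℂ} :
    Matrix.diagonal x ∈ LinearMap.ker L ↔ x ∈ stationary (gamma C) := by
  have hdeph : ∀ i : Fin N, dephasing C i i = 0 := fun i => by simp [dephasing]
  have hentry : ∀ i, L (Matrix.diagonal x) i i =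
      ∑ j, (gamma C i j : ℂ) * x j - (∑ k, (gamma C k i : ℂ)) * x i := by
    intro i
    rw [hL, if_pos rfl, kappa_self, hdeph, outRate]
    simp only [Matrix.diagonal_apply_eq]
    push_cast
    ring
  rw [LinearMap.mem_ker, mem_stationary]
  constructor
  · intro h0 i
    rw [← sub_eq_zero, ← hentry, h0, Matrix.zero_apply]
  · intro hx
    ext i j
    by_cases hij : i = j
    · rw [← hij, hentry, hx, sub_self, Matrix.zero_apply]
    · rw [hL, if_neg hij, Matrix.diagonal_apply_ne _ hij, Matrix.diagonal_apply_ne _ (Ne.symm hij)]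
      simp

theorem HasEntryFormula.isDirectSum {N : ℕ} {L : Mat N →ₗ[ℂ] Mat N} {h : Fin N → ℝ}
    {C : Matrix (GMIndex N) (GMIndex N) ℂ} (hL : HasEntryFormula L h C) :
    IsDirectSumOfBlockKernels L
      ((stationary (gamma C)).map (Matrix.diagonalLinearMap (Fin N) ℂ ℂ)) (LinearMap.ker L) := by
  constructor
  · refine iSupIndep_of_entryClass ?_
    rintro (_ | p) A hA i j hij
    · obtain ⟨x, -, rfl⟩ := hA
      exact Matrix.diagonal_apply_ne _ fun h => hij (entryClass_eq_none.2 h)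
    · obtain ⟨x, y, -, rfl⟩ := (hL.mem_kerPairBlock p.2).1 hA
      rw [Ne, entryClass_eq_some, not_or] at hij
      exact pairComb_apply_of_ne p.2 _ _ hij.1 hij.2
  · apply le_antisymm
    · refine iSup_le ?_
      rintro (_ | p) A hA
      · obtain ⟨x, hx, rfl⟩ := hA
        exact hL.diagonal_mem_ker_iff.2 hx
      · obtain ⟨x, y, -, rfl⟩ := (hL.mem_kerPairBlock p.2).1 hA
        exact (hL.pairComb_mem_ker_iff p.2).2 hA
    · intro A hA
      have hpart : ∀ o, classPart o A ∈ LinearMap.ker L := fun o => by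
        rw [LinearMap.mem_ker, hL.apply_classPart, LinearMap.mem_ker.1 hA]
        ext i j
        simp [classPart_apply]
      rw [← sum_classPart A]
      refine Submodule.sum_mem _ fun o _ => Submodule.mem_iSup_of_mem o ?_
      have ho := hpart o
      rcases o with _ | p
      · rw [classPart_none] at ho ⊢
        exact ⟨_, hL.diagonal_mem_ker_iff.1 ho, rfl⟩
      · rw [classPart_some] at ho ⊢
        exact (hL.pairComb_mem_ker_iff p.2).1 ho

/-! ### Diagonal coefficient matrices -/

theorem cPair_eq_zero_of_isDiag {N : ℕ} {C : Matrix (GMIndex N) (GMIndex N) ℂ} (hC : C.IsDiag)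
    (i j : Fin N) : cPair C i j = 0 := by
  rw [cPair]
  split_ifs with hij
  · exact hC fun h => hij (congrArg (fun q : OffIndex N => q.1.1) (Sum.inl_injective h))
  · rfl

/-- The two directions differ only in the sign of $b$, which is zero here; this is what lets
directions be forgotten. -/
theorem gamma_symm_of_isDiag {N : ℕ} {C : Matrix (GMIndex N) (GMIndex N) ℂ} (hC : C.IsDiag)
    (i j : Fin N) : gamma C i j = gamma C j i := by
  have hb : ∀ i j, bOff C i j = 0 := fun i j => by
    rw [bOff, cPair_eq_zero_of_isDiag hC, Complex.zero_im]
  rcases lt_trichotomy i j with h | rfl | h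
  · rw [gamma_of_lt C h, gamma_of_gt C h, hb]
    ring
  · rfl
  · rw [gamma_of_lt C h, gamma_of_gt C h, hb]
    ring

theorem isIsolatedVertex_iff {N : ℕ} {C : Matrix (GMIndex N) (GMIndex N) ℂ} (hC : C.IsDiag)
    (k : Fin N) : IsIsolatedVertex (undirected C) k ↔ IsSink (gamma C) k :=
  forall_congr' fun _ => not_congr (fromRel_hasEdge_adj (gamma_symm_of_isDiag hC))

theorem isIsolatedEdge_iff {N : ℕ} {C : Matrix (GMIndex N) (GMIndex N) ℂ} (hC : C.IsDiag)
    (k l : Fin N) : IsIsolatedEdge (undirected C) k l ↔ IsTwoSink (gamma C) k l := by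
  have hadj : ∀ i j, (undirected C).Adj i j ↔ HasEdge (gamma C) i j := fun _ _ =>
    fromRel_hasEdge_adj (gamma_symm_of_isDiag hC)
  simp only [IsIsolatedEdge, IsTwoSink, hadj]
  refine and_congr_right fun h => ?_
  rw [and_iff_right (a := HasEdge (gamma C) l k) ((hadj l k).1 ((hadj k l).2 h).symm)]

theorem isSingularTwoSink_iff {N : ℕ} {C : Matrix (GMIndex N) (GMIndex N) ℂ} (hC : C.IsDiag)
    (k l : Fin N) : IsSingularTwoSink C k l ↔
      IsIsolatedEdge (undirected C) k l ∧ cOff C k l * cOff C l k = 0 := by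
  rw [IsSingularTwoSink, isIsolatedEdge_iff hC, aOff, cPair_eq_zero_of_isDiag hC, Complex.zero_re]
  simp

theorem HasEntryFormula.kerPairBlock_of_isDiag_left {N : ℕ} {L : Mat N →ₗ[ℂ] Mat N}
    {h : Fin N → ℝ} {C : Matrix (GMIndex N) (GMIndex N) ℂ} (hL : HasEntryFormula L h C)
    (hC : IsPairPositive C) (hdiag : C.IsDiag) {k l : Fin N} (hkl : k < l)
    (hdet : (pairBlock L k l).det = 0) (hS : IsTwoSink (gamma C) k l) (h0 : cOff C l k = 0) :
    kerPairBlock L k l = Submodule.span ℂ {lamOff k l} := by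
  have ha : aOff C k l = 0 := by rw [aOff, cPair_eq_zero_of_isDiag hdiag, Complex.zero_re]
  -- The mutual edges have total weight $c_{k\ell}+c_{\ell k}>0$, so only one of the two
  -- coefficients can vanish.
  have hc : cOff C k l ≠ 0 := by
    have : 0 < cOff C k l := by linarith [gamma_add_gamma C hkl, hS.1.2, hS.2.1.2]
    exact this.ne'
  ext A
  rw [hL.mem_kerPairBlock_of_singular hC hkl hdet, Submodule.mem_span_singleton, h0, ha]
  simp [pairComb, hc]

theorem HasEntryFormula.kerPairBlock_of_isDiag_right {N : ℕ} {L : Mat N →ₗ[ℂ] Mat N}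
    {h : Fin N → ℝ} {C : Matrix (GMIndex N) (GMIndex N) ℂ} (hL : HasEntryFormula L h C)
    (hC : IsPairPositive C) (hdiag : C.IsDiag) {k l : Fin N} (hkl : k < l)
    (hdet : (pairBlock L k l).det = 0) (hS : IsTwoSink (gamma C) k l) (h0 : cOff C k l = 0) :
    kerPairBlock L k l = Submodule.span ℂ {lamOff l k} := by
  have ha : aOff C k l = 0 := by rw [aOff, cPair_eq_zero_of_isDiag hdiag, Complex.zero_re]
  have hc : cOff C l k ≠ 0 := by
    have : 0 < cOff C l k := by linarith [gamma_add_gamma C hkl, hS.1.2, hS.2.1.2]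
    exact this.ne'
  ext A
  rw [hL.mem_kerPairBlock_of_singular hC hkl hdet, Submodule.mem_span_singleton, h0, ha]
  simp [pairComb, hc]

end QDS

/-! ### The kernel of the generator -/

theorem theorem6p2 {N : ℕ} (L : QDS.Mat N →ₗ[ℂ] QDS.Mat N) (h : Fin N → ℝ)
    (C : Matrix (QDS.GMIndex N) (QDS.GMIndex N) ℂ)
    (hL : QDS.IsQDSGenerator L)
    (hform : ∀ ρ, L ρ = QDS.gellMannForm (Matrix.diagonal fun n => (h n : ℂ)) C ρ)
    (hOD : C.toBlocks₁₂ = 0) (hDO : C.toBlocks₂₁ = 0)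
    (hO : QDS.IsPairBlockDiagonal C.toBlocks₁₁)
    (hD : C.toBlocks₂₂.IsDiag) :
    (QDS.IsDirectSumOfBlockKernels L
        (Submodule.span ℂ
          {d | ∃ S, QDS.IsTSCC (QDS.gamma C) S ∧ d = QDS.dTSCC (QDS.gamma C) S})
        (LinearMap.ker L) ∧
      ∀ k l : Fin N, k < l →
        ((QDS.pairBlock L k l).det = 0 ↔
          h k = h l ∧ QDS.DiagVanishes C k l ∧
            ((QDS.IsSink (QDS.gamma C) k ∧ QDS.IsSink (QDS.gamma C) l) ∨
              QDS.IsSingularTwoSink C k l)) ∧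
        ((QDS.pairBlock L k l).det = 0 →
          (QDS.IsSink (QDS.gamma C) k ∧ QDS.IsSink (QDS.gamma C) l →
            QDS.kerPairBlock L k l = Submodule.span ℂ {QDS.lamOff k l, QDS.lamOff l k}) ∧
          (QDS.IsSingularTwoSink C k l →
            (¬ (QDS.cOff C k l = -QDS.aOff C k l ∧ QDS.cOff C l k = -QDS.aOff C k l) →
              QDS.kerPairBlock L k l = Submodule.span ℂ
                {((QDS.cOff C k l + QDS.aOff C k l : ℝ) : ℂ) • QDS.lamOff k l +
                  ((QDS.cOff C l k + QDS.aOff C k l : ℝ) : ℂ) • QDS.lamOff l k}) ∧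
            (QDS.cOff C k l = -QDS.aOff C k l ∧ QDS.cOff C l k = -QDS.aOff C k l →
              QDS.kerPairBlock L k l = Submodule.span ℂ
                {QDS.lamOff k l - QDS.lamOff l k})))) ∧
    (C.IsDiag →
      QDS.IsDirectSumOfBlockKernels L
        (Submodule.span ℂ (Set.range (QDS.dComponent (QDS.undirected C))))
        (LinearMap.ker L) ∧
      ∀ k l : Fin N, k < l →
        ((QDS.pairBlock L k l).det = 0 ↔
          h k = h l ∧ QDS.DiagVanishes C k l ∧
            ((QDS.IsIsolatedVertex (QDS.undirected C) k ∧
                QDS.IsIsolatedVertex (QDS.undirected C) l) ∨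
              (QDS.IsIsolatedEdge (QDS.undirected C) k l ∧
                QDS.cOff C k l * QDS.cOff C l k = 0))) ∧
        ((QDS.pairBlock L k l).det = 0 →
          (QDS.IsIsolatedVertex (QDS.undirected C) k ∧
              QDS.IsIsolatedVertex (QDS.undirected C) l →
            QDS.kerPairBlock L k l = Submodule.span ℂ {QDS.lamOff k l, QDS.lamOff l k}) ∧
          (QDS.IsIsolatedEdge (QDS.undirected C) k l ∧ QDS.cOff C k l * QDS.cOff C l k = 0 →
            (QDS.cOff C l k = 0 →
              QDS.kerPairBlock L k l = Submodule.span ℂ {QDS.lamOff k l}) ∧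
            (QDS.cOff C k l = 0 →
              QDS.kerPairBlock L k l = Submodule.span ℂ {QDS.lamOff l k})))) := by
  have hC := hL.isPairPositive hform hOD hDO hO hD
  have hentry : QDS.HasEntryFormula L h C := fun ρ m n => by
    rw [hform]
    exact QDS.gellMannForm_apply h hC hOD hDO hO hD ρ m n
  refine ⟨⟨?_, fun k l hkl => ⟨hentry.singular_iff hC hkl, fun hdet => ⟨fun hs =>
    hentry.kerPairBlock_of_isSink hC hkl hdet hs.1 hs.2, fun hs => ⟨fun hne =>
    hentry.kerPairBlock_of_singular hC hkl hdet hne, fun heq =>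
    hentry.kerPairBlock_of_antidiagonal hC hkl hdet hs.1 heq.1 heq.2⟩⟩⟩⟩, fun hdiag =>
    ⟨?_, fun k l hkl => ⟨?_, fun hdet => ⟨fun hs => ?_, fun hs => ⟨fun h0 => ?_, fun h0 => ?_⟩⟩⟩⟩⟩
  · rw [QDS.span_dTSCC hC.gamma_nonneg]
    exact hentry.isDirectSum
  · rw [QDS.undirected, QDS.span_dComponent hC.gamma_nonneg (QDS.gamma_symm_of_isDiag hdiag)]
    exact hentry.isDirectSum
  · rw [QDS.isIsolatedVertex_iff hdiag, QDS.isIsolatedVertex_iff hdiag,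
      ← QDS.isSingularTwoSink_iff hdiag]
    exact hentry.singular_iff hC hkl
  · rw [QDS.isIsolatedVertex_iff hdiag, QDS.isIsolatedVertex_iff hdiag] at hs
    exact hentry.kerPairBlock_of_isSink hC hkl hdet hs.1 hs.2
  · exact hentry.kerPairBlock_of_isDiag_left hC hdiag hkl hdet
      ((QDS.isIsolatedEdge_iff hdiag k l).1 hs.1) h0
  · exact hentry.kerPairBlock_of_isDiag_right hC hdiag hkl hdet
      ((QDS.isIsolatedEdge_iff hdiag k l).1 hs.1) h0
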